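/- **Proposition (quasi-locality of the parent Hamiltonian).** Let $\Lambda$ be a finite $D$-dimensional lattice, i.e. a finite set with a distance such that $|\{y:\operatorname{dist}(x,y)\le r\}|\le\kappa(1+r)^D$ for all $x\in\Lambda$, $r\ge 0$ (several modes may sit at one site, at distance $0$). Consider either one qubit per element of $\Lambda$, where an operator has support $I\subseteq\Lambda$ if it has the form $\mathrm{id}_{\Lambda\setminus I}\otimes B$, or one fermionic mode per element of $\Lambda$, where an operator has support $I$ if it is a polynomial in $a_i,a_i^\dagger$, $i\in I$. Let $H=\sum_{I\subseteq\Lambda}h_I$ with $h_I$ Hermitian, supported on $I$ (and even, in the fermionic case), with interactions that decay at least exponentially: $$\sum_{I\ni x,y}\|h_I\|\le J e^{-\mu\operatorname{dist}(x,y)}\qquad\text{for all }x,y\in\Lambda ,\quad \mu>0 .$$ Let $\{A^a\}_{a\in\mathcal A}$ be a finite family of self-adjoint jump operators with $\|A^a\|\le 1$, each supported on a set $S_a\subseteq\Lambda$ of diameter at most $R$. Fix $\beta>0$, let $\sigma=e^{-\beta H}/\operatorname{Tr}e^{-\beta H}$ and let $\hat f(\nu)=e^{-(\beta\nu+1)^2/8+1/8}$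 be the Gaussian filter function. For an operator $X$ and a Bohr frequency $\nu$ (a difference of two eigenvalues of $H$) put $X_\nu=\sum_{E-E'=\nu}P_EXP_{E'}$, where $P_E$ are the spectral projections of $H$, and let $$L_a=\sum_\nu\hat f(\nu)A^a_\nu,\qquad G_a=\frac i2\sum_\nu\tanh\!\Big(\frac{\beta\nu}4\Big)(L_a^\dagger L_a)_\nu,\qquad G=\sum_aG_a,$$ $$\mathcal L^\dagger[\rho]=-i[G,\rho]+\sum_a\Big(L_a\rho L_a^\dagger-\tfrac12\{L_a^\dagger L_a,\rho\}\Big),\qquad \mathcal H=\Gamma_\sigma^{-1/2}\circ\mathcal L^\dagger\circ\Gamma_\sigma^{1/2},\qquad \Gamma_\sigma[\rho]=\sigma^{1/2}\rho\,\sigma^{1/2}.$$ Then the parent Hamiltonian $\mathcal H$ is a sum of quasi-local terms. Precisely, $\mathcal H=\sum_{a}\mathcal H_a$, where $\mathcal H_a$ is the parent Hamiltonian built from $H$ and the single jump operator $A^a$, and there are constants $C,\eta>0$, depending only on $\beta,D,\kappa,J,\mu,R$ and on whether the system is of qubits or of fermions (in particular not on $\Lambda$, $H$ or the jump operators), such that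 for every $a\in\mathcal A$ and $r\ge0$ the following holds. Let $B_r(a)=\{x:\operatorname{dist}(x,y)\le r\text{ for some }y\in S_a\}$, let $H_{B_r(a)}=\sum_{I\subseteq B_r(a)}h_I$, and let $L_a^{(r)},\tilde L_a^{(r)},\tilde G_a^{(r)},\mathcal H_a^{(r)}$ be obtained from $L_a$, $\tilde L_a=\sigma^{-1/4}L_a\sigma^{1/4}$, $\tilde G_a=\sigma^{-1/4}G_a\sigma^{1/4}$ and $\mathcal H_a$ by replacing $H$ by $H_{B_r(a)}$ everywhere (also in $\sigma$). Then $L_a^{(r)},\tilde L_a^{(r)},\tilde G_a^{(r)}$ are supported on $B_r(a)$, $\mathcal H_a^{(r)}$ is a linear combination of maps $\rho\mapsto X\rho Y$ with $X,Y$ supported on $B_r(a)$, and $$\|\mathcal H_a-\mathcal H_a^{(r)}\|,\ \ \|L_a-L_a^{(r)}\|,\ \ \|\tilde L_a-\tilde L_a^{(r)}\|,\ \ \|\tilde G_a-\tilde G_a^{(r)}\|\ \le\ C e^{-\eta r}.$$ The norm of an operator is the spectral norm, and the norm of a map on operators is the operator norm with respect to the Hilbert–Schmidt norm (the spectral norm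 of its vectorisation). -/

import Mathlib

open scoped Matrix Matrix.Norms.L2Operator

/-- Operators on the `2 ^ |Λ|`-dimensional space with orthonormal basis `|x⟩`, `x : Λ → Bool`:
the space of one qubit per element of `Λ`, and also the Fock space of one fermionic mode per
element of `Λ`. The norm in use is the spectral norm. -/
abbrev Op (Λ : Type) : Type := Matrix (Λ → Bool) (Λ → Bool) ℂ

/-- Linear maps on operators. -/
abbrev SuperOp (Λ : Type) [Fintype Λ] : Type := Op Λ →ₗ[ℂ] Op Λ

inductive SystemKind : Type
  | qubit
  | fermion

section Support

variable {Λ : Type} [Fintype Λ] [LinearOrder Λ]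

/-- The fermionic annihilation operator `a_i` (Jordan-Wigner form): it sends `|y⟩` to
`(-1) ^ #{j < i : y_j = 1} |y - e_i⟩` if `y_i = 1`, and to `0` if `y_i = 0`.
The creation operator is `(annihilation i)ᴴ`. -/
noncomputable def annihilation (i : Λ) : Op Λ :=
  fun x y => if y i = true ∧ x = Function.update y i false then
    (-1 : ℂ) ^ (Finset.univ.filter (fun j : Λ => j < i ∧ y j = true)).card else 0

/-- The parity operator `(-1) ^ N_tot`. -/
noncomputable def parityOp : Op Λ :=
  Matrix.diagonal fun x => (-1 : ℂ) ^ (Finset.univ.filter (fun j : Λ => x j = true)).card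

/-- The operator `A` has support (contained in) `I`.
Qubits: `A = 1 ⊗ B` with `B` acting on the qubits in `I`.
Fermions: `A` is a polynomial in `a_i`, `a_i†` with `i ∈ I`. -/
def IsSupportedOn (k : SystemKind) (I : Finset Λ) (A : Op Λ) : Prop :=
  match k with
  | SystemKind.qubit => ∃ B : Matrix (I → Bool) (I → Bool) ℂ, ∀ x y : Λ → Bool,
      A x y = if ∀ j : Λ, j ∉ I → x j = y j then B (fun i => x i) (fun i => y i) else 0
  | SystemKind.fermion =>
      A ∈ Algebra.adjoin ℂ
        ({B : Op Λ | ∃ i ∈ I, B = annihilation i} ∪ {B : Op Λ | ∃ i ∈ I, B = (annihilation i)ᴴ})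

/-- Fermionic Hamiltonian terms have to be even; there is no condition on qubit terms. -/
def IsPhysical (k : SystemKind) (A : Op Λ) : Prop :=
  match k with
  | SystemKind.qubit => True
  | SystemKind.fermion => parityOp * A * parityOp = A

/-- A superoperator has support in `I` if it is a linear combination of maps `ρ ↦ X ρ Y`
with `X`, `Y` supported on `I`. -/
def IsSuperSupportedOn (k : SystemKind) (I : Finset Λ) (T : SuperOp Λ) : Prop :=
  T ∈ Submodule.span ℂ {T' : SuperOp Λ | ∃ X Y : Op Λ, IsSupportedOn k I X ∧ IsSupportedOn k I Y ∧
    T' = LinearMap.mulLeft ℂ X ∘ₗ LinearMap.mulRight ℂ Y}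

/-- The operator norm of a superoperator with respect to the Hilbert-Schmidt norm, i.e. the
spectral norm of its vectorisation (`ρ ↦ X ρ Y` becomes `X ⊗ Yᵀ`). -/
noncomputable def superNorm (T : SuperOp Λ) : ℝ :=
  ‖LinearMap.toMatrix (Matrix.stdBasis ℂ (Λ → Bool) (Λ → Bool))
    (Matrix.stdBasis ℂ (Λ → Bool) (Λ → Bool)) T‖

end Support

section Gibbs

variable {Λ : Type} [Fintype Λ] [LinearOrder Λ]

/-- The finite set of eigenvalues of `H`. -/
noncomputable def energies (H : Op Λ) : Finset ℝ :=
  (Matrix.finite_real_spectrum (A := H)).toFinset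

/-- The projector onto the eigenspace of the Hermitian matrix `H` with eigenvalue `E`. -/
noncomputable def eigenProj (H : Op Λ) (E : ℝ) : Op Λ :=
  cfc (fun x : ℝ => if x = E then (1 : ℝ) else 0) H

/-- The set of Bohr frequencies `{E - E'}`. -/
noncomputable def bohrFreqs (H : Op Λ) : Finset ℝ :=
  (energies H ×ˢ energies H).image fun p => p.1 - p.2

/-- The component `A_ν = ∑_{E - E' = ν} P_E A P_{E'}`. -/
noncomputable def bohrComponent (H A : Op Λ) (ν : ℝ) : Op Λ :=
  ∑ p ∈ (energies H ×ˢ energies H).filter (fun p => p.1 - p.2 = ν),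
    eigenProj H p.1 * A * eigenProj H p.2

/-- `φ(ad_H)(A) = ∑_ν φ(ν) A_ν`, the sum being over the Bohr frequencies. -/
noncomputable def bohrFilter (φ : ℝ → ℂ) (H A : Op Λ) : Op Λ :=
  ∑ ν ∈ bohrFreqs H, φ ν • bohrComponent H A ν

/-- The Gaussian filter function in the frequency domain. -/
noncomputable def gaussianFilter (β ν : ℝ) : ℝ :=
  Real.exp (-(β * ν + 1) ^ 2 / 8 + 1 / 8)

/-- The Lindblad operator `L = f̂(ad_H)(A)` of the jump operator `A`. -/
noncomputable def lindbladOp (β : ℝ) (H A : Op Λ) : Op Λ :=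
  bohrFilter (fun ν => (gaussianFilter β ν : ℂ)) H A

/-- The coherent term `G = (i/2) ∑_ν tanh(β ν / 4) (∑_a L_a† L_a)_ν`. -/
noncomputable def coherentTerm {α : Type} [Fintype α] (β : ℝ) (H : Op Λ) (A : α → Op Λ) : Op Λ :=
  bohrFilter (fun ν => Complex.I / 2 * (Real.tanh (β * ν / 4) : ℂ)) H
    (∑ a, (lindbladOp β H (A a))ᴴ * lindbladOp β H (A a))

/-- The Lindbladian `𝓛†[ρ] = -i[G, ρ] + ∑_a (L_a ρ L_a† - ½ {L_a† L_a, ρ})`. -/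
noncomputable def lindbladianDagger {α : Type} [Fintype α] (β : ℝ) (H : Op Λ) (A : α → Op Λ) :
    SuperOp Λ :=
  -Complex.I • (LinearMap.mulLeft ℂ (coherentTerm β H A)
      - LinearMap.mulRight ℂ (coherentTerm β H A))
    + ∑ a, (LinearMap.mulLeft ℂ (lindbladOp β H (A a))
          ∘ₗ LinearMap.mulRight ℂ (lindbladOp β H (A a))ᴴ
        - (1 / 2 : ℂ) • (LinearMap.mulLeft ℂ ((lindbladOp β H (A a))ᴴ * lindbladOp β H (A a))
          + LinearMap.mulRight ℂ ((lindbladOp β H (A a))ᴴ * lindbladOp β H (A a))))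

/-- The Gibbs state `σ_β = e^{-β H} / Tr e^{-β H}`. -/
noncomputable def gibbsState (β : ℝ) (H : Op Λ) : Op Λ :=
  (Matrix.trace (NormedSpace.exp (-β • H)))⁻¹ • NormedSpace.exp (-β • H)

/-- The real power `σ_β ^ s`. -/
noncomputable def gibbsPow (β : ℝ) (H : Op Λ) (s : ℝ) : Op Λ :=
  cfc (fun x : ℝ => x ^ s) (gibbsState β H)

/-- The power `Γ_σ ^ s`, `ρ ↦ σ^{s/2} ρ σ^{s/2}`, of `Γ_σ[ρ] = σ^{1/2} ρ σ^{1/2}`, `σ = σ_β`. -/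
noncomputable def gammaPow (β : ℝ) (H : Op Λ) (s : ℝ) : SuperOp Λ :=
  LinearMap.mulLeft ℂ (gibbsPow β H (s / 2)) ∘ₗ LinearMap.mulRight ℂ (gibbsPow β H (s / 2))

/-- The parent Hamiltonian (discriminant) `Γ_σ^{-1/2} ∘ 𝓛† ∘ Γ_σ^{1/2}`. -/
noncomputable def parentHamiltonian {α : Type} [Fintype α] (β : ℝ) (H : Op Λ) (A : α → Op Λ) :
    SuperOp Λ :=
  gammaPow β H (-1 / 2) ∘ₗ lindbladianDagger β H A ∘ₗ gammaPow β H (1 / 2)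

/-- The contribution of a single jump operator to the parent Hamiltonian. -/
noncomputable def parentTerm (β : ℝ) (H A : Op Λ) : SuperOp Λ :=
  parentHamiltonian β H (fun _ : Unit => A)

/-- `L̃ = σ^{-1/4} L σ^{1/4}`. -/
noncomputable def tildeL (β : ℝ) (H A : Op Λ) : Op Λ :=
  gibbsPow β H (-1 / 4) * lindbladOp β H A * gibbsPow β H (1 / 4)

/-- `G̃ = σ^{-1/4} G σ^{1/4}` for the coherent term `G` of a single jump operator. -/
noncomputable def tildeG (β : ℝ) (H A : Op Λ) : Op Λ :=
  gibbsPow β H (-1 / 4) * coherentTerm β H (fun _ : Unit => A) * gibbsPow β H (1 / 4)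

end Gibbs

section Locality

variable {Λ : Type} [Fintype Λ] [LinearOrder Λ] [PseudoMetricSpace Λ]

open Classical in
/-- The ball of radius `r` around the set `S`. -/
noncomputable def nbhd (S : Finset Λ) (r : ℝ) : Finset Λ :=
  Finset.univ.filter fun x => ∃ y ∈ S, dist x y ≤ r

/-- The Hamiltonian `∑_I h_I` restricted to the region `Ω`: the terms with `I ⊆ Ω` are kept. -/
noncomputable def truncatedHam (h : Finset Λ → Op Λ) (Ω : Finset Λ) : Op Λ :=
  ∑ I ∈ Finset.univ.filter (fun I : Finset Λ => I ⊆ Ω), h I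

/-- `X' r` are local approximations of `X` around `S` with error at most `C e^{-η r}`. -/
def IsQuasiLocalBy (k : SystemKind) (S : Finset Λ) (C η : ℝ) (X : Op Λ) (X' : ℝ → Op Λ) : Prop :=
  ∀ r : ℝ, 0 ≤ r → IsSupportedOn k (nbhd S r) (X' r) ∧ ‖X - X' r‖ ≤ C * Real.exp (-η * r)

/-- `T' r` are local approximations of the superoperator `T` around `S` with error at most
`C e^{-η r}`. -/
def IsSuperQuasiLocalBy (k : SystemKind) (S : Finset Λ) (C η : ℝ) (T : SuperOp Λ)
    (T' : ℝ → SuperOp Λ) : Prop :=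
  ∀ r : ℝ, 0 ≤ r → IsSuperSupportedOn k (nbhd S r) (T' r) ∧
    superNorm (T - T' r) ≤ C * Real.exp (-η * r)

end Locality

/-! ### Functional calculus of a Hermitian matrix and of its commutator map. -/

section Spectral

variable {Λ : Type} [Fintype Λ] [LinearOrder Λ]

/-! Every ingredient is a function of ad_H applied to a jump operator or to a product of such
functions. Conjugation by σ^{1/4} multiplies a symbol by e^{βν/4}, which only shifts the parameter s
of a Gaussian symbol e^{-β²ν²/8 + sν}. Hence L̃ and M̃ = σ^{-1/4} L†L σ^{1/4} are again built from
Gaussian filters (`tildeL_eq`, `tildeLL_eq`), and no imaginary-time evolution has to be controlled.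
If the symbol is the Fourier transform of a kernel f, the filter is ∫ f(t) e^{itH} X e^{-itH} dt
(`bohrFilter_eq_integral`), so locality becomes a question about real-time dynamics.

A Lieb-Robinson argument with exponentially growing weights (`weightedComm_le`,
`exists_norm_evol_sub_evol_le`) shows that evolving A under H or under its truncation to the ball of
radius r differs by at most c e^{-μr/2} e^{v|t|}. The relation `IsClose` records an error of the
shape δ e^{w|t|}; it survives products, sums and filters by kernels integrable against every
exponential.

The delicate term is G̃, the filter (i/2) tanh(βν/4) applied to M̃. The expansion tanh(βν/4) = (8/β)
Σ_k ν/(ν² + b_k²), with b_k = 2π(2k+1)/β, raises two difficulties. The kernels of ν/(ν² + b_k²) have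
L¹ norm of order 1/b_k, which is not summable. So ν is moved onto M̃: since ad_H is a derivation,
ad_H M̃ is again a sum of products of filters with good kernels (`bohrFilter_ofReal_tildeLL`), and
the remaining Lorentzians cost only O(1/b_k²). Moreover the Lorentzian kernels decay only like
e^{-b_k|t|}, while v may exceed b_0 = 2π/β. Interpolating with the trivial bound 2
(`le_two_mul_rpow_of_le`) lowers the growth rate to θv ≤ π/β at the price of the smaller spatial
rate θμ/2.

The parent Hamiltonian of one jump is ρ ↦ L̃ρL̃† + Kρ + ρK† with K = -iG̃ - M̃/2 (`parentTerm_eq`),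
so its locality follows from that of L̃, G̃ and M̃. Exact supports of the approximants hold because
functions of a Hermitian matrix are polynomials in it. -/

lemma continuousOn_spectrum (H : Op Λ) (f : ℝ → ℝ) : ContinuousOn f (spectrum ℝ H) :=
  (Matrix.finite_real_spectrum (A := H)).continuousOn f

lemma cfc_eq_sum_eigenProj {H : Op Λ} (hH : H.IsHermitian) (f : ℝ → ℝ) :
    cfc f H = ∑ E ∈ energies H, f E • eigenProj H E := by
  have hH' : IsSelfAdjoint H := hH
  have h1 : ∀ E, f E • eigenProj H E = cfc (fun x : ℝ => f E • (if x = E then (1 : ℝ) else 0)) H := by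
    intro E
    rw [eigenProj, cfc_smul _ _ _ (continuousOn_spectrum _ _)]
  simp_rw [h1]
  rw [← cfc_sum _ _ _ (fun i _ => continuousOn_spectrum _ _)]
  apply cfc_congr
  intro x hx
  have hx' : x ∈ energies H := by simpa [energies] using hx
  simp [Finset.sum_apply, hx']

lemma sum_eigenProj {H : Op Λ} (hH : H.IsHermitian) : ∑ E ∈ energies H, eigenProj H E = 1 := by
  have hH' : IsSelfAdjoint H := hH
  have := cfc_eq_sum_eigenProj hH (fun _ => 1)
  rw [cfc_const_one ℝ H] at this
  simpa using this.symm

lemma eigenProj_mul_eigenProj (H : Op Λ) (E E' : ℝ) :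
    eigenProj H E * eigenProj H E' = if E = E' then eigenProj H E else 0 := by
  rw [eigenProj, eigenProj, ← cfc_mul _ _ _ (continuousOn_spectrum _ _) (continuousOn_spectrum _ _)]
  split_ifs with h
  · subst h
    congr 1
    ext x
    simp
  · rw [← cfc_zero ℝ H]
    congr 1
    ext x
    by_cases hx : x = E
    · subst hx; simp [h]
    · simp [hx]

lemma conjTranspose_eigenProj (H : Op Λ) (E : ℝ) : (eigenProj H E)ᴴ = eigenProj H E :=
  (cfc_predicate (p := IsSelfAdjoint) (fun x : ℝ => if x = E then (1 : ℝ) else 0) H)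

/-- The function `g` of the Hermitian matrix `H`, for complex-valued `g`. -/
noncomputable def specFun (H : Op Λ) (g : ℝ → ℂ) : Op Λ := ∑ E ∈ energies H, g E • eigenProj H E

lemma specFun_mul (H : Op Λ) (f g : ℝ → ℂ) :
    specFun H f * specFun H g = specFun H (fun x => f x * g x) := by
  simp only [specFun, Finset.sum_mul, Finset.mul_sum, smul_mul_smul_comm, eigenProj_mul_eigenProj]
  refine Finset.sum_congr rfl fun E hE => ?_
  simp [hE]

lemma specFun_one {H : Op Λ} (hH : H.IsHermitian) : specFun H (fun _ => 1) = 1 := by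
  simp [specFun, sum_eigenProj hH]

lemma specFun_ofReal {H : Op Λ} (hH : H.IsHermitian) (f : ℝ → ℝ) :
    specFun H (fun x => (f x : ℂ)) = cfc f H := by
  rw [cfc_eq_sum_eigenProj hH]
  refine Finset.sum_congr rfl fun E _ => ?_
  ext i j; simp

lemma specFun_id {H : Op Λ} (hH : H.IsHermitian) : specFun H (fun x => (x : ℂ)) = H := by
  have hH' : IsSelfAdjoint H := hH
  rw [specFun_ofReal hH (fun x => x), cfc_id' ℝ H]

lemma conjTranspose_specFun (H : Op Λ) (g : ℝ → ℂ) :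
    (specFun H g)ᴴ = specFun H (fun x => star (g x)) := by
  simp [specFun, Matrix.conjTranspose_sum, conjTranspose_eigenProj]

/-- Pairs of eigenvalues are grouped by their difference. Later arguments use this double sum and
never the individual Bohr components. -/
lemma bohrFilter_eq_sum (φ : ℝ → ℂ) (H A : Op Λ) :
    bohrFilter φ H A = ∑ E ∈ energies H, ∑ E' ∈ energies H,
      φ (E - E') • (eigenProj H E * A * eigenProj H E') := by
  rw [bohrFilter, ← Finset.sum_product' _ _
    (fun E E' => φ (E - E') • (eigenProj H E * A * eigenProj H E'))]
  rw [← Finset.sum_fiberwise_of_maps_to (s := energies H ×ˢ energies H) (t := bohrFreqs H)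
    (g := fun p => p.1 - p.2) (fun p hp => Finset.mem_image_of_mem _ hp)]
  refine Finset.sum_congr rfl fun ν _ => ?_
  rw [bohrComponent, Finset.smul_sum]
  refine Finset.sum_congr rfl fun p hp => ?_
  rw [(Finset.mem_filter.1 hp).2]

/-- Orthogonality of the spectral projections makes φ ↦ φ(ad_H) multiplicative; in particular all
filters of one Hamiltonian commute. -/
lemma bohrFilter_mul_symbol (f g : ℝ → ℂ) (H A : Op Λ) :
    bohrFilter (fun ν => f ν * g ν) H A = bohrFilter f H (bohrFilter g H A) := by
  have key : ∀ E ∈ energies H, ∀ E' ∈ energies H,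
      eigenProj H E * bohrFilter g H A * eigenProj H E'
        = g (E - E') • (eigenProj H E * A * eigenProj H E') := by
    intro E hE E' hE'
    rw [bohrFilter_eq_sum, Finset.mul_sum, Finset.sum_mul, Finset.sum_eq_single E]
    · rw [Finset.mul_sum, Finset.sum_mul, Finset.sum_eq_single E']
      · rw [mul_smul_comm, smul_mul_assoc, ← mul_assoc, ← mul_assoc, eigenProj_mul_eigenProj,
          if_pos rfl, mul_assoc _ (eigenProj H E') (eigenProj H E'), eigenProj_mul_eigenProj,
          if_pos rfl]
      · intro F _ hF
        rw [mul_smul_comm, smul_mul_assoc, mul_assoc _ _ (eigenProj H E'), mul_assoc _ _ (eigenProj H E'),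
          eigenProj_mul_eigenProj, if_neg hF]
        simp
      · exact fun h => absurd hE' h
    · intro F _ hF
      rw [Finset.mul_sum, Finset.sum_mul]
      refine Finset.sum_eq_zero fun F' _ => ?_
      rw [mul_smul_comm, ← mul_assoc, ← mul_assoc, eigenProj_mul_eigenProj, if_neg hF.symm]
      simp
    · exact fun h => absurd hE h
  rw [bohrFilter_eq_sum f, bohrFilter_eq_sum]
  refine Finset.sum_congr rfl fun E hE => Finset.sum_congr rfl fun E' hE' => ?_
  rw [key E hE E' hE', smul_smul]

lemma bohrFilter_add_op (φ : ℝ → ℂ) (H A B : Op Λ) :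
    bohrFilter φ H (A + B) = bohrFilter φ H A + bohrFilter φ H B := by
  simp [bohrFilter_eq_sum, mul_add, add_mul, Finset.sum_add_distrib]

lemma bohrFilter_sum_op {ι : Type} (s : Finset ι) (φ : ℝ → ℂ) (H : Op Λ) (A : ι → Op Λ) :
    bohrFilter φ H (∑ i ∈ s, A i) = ∑ i ∈ s, bohrFilter φ H (A i) := by
  classical
  induction s using Finset.induction_on with
  | empty => simp [bohrFilter_eq_sum]
  | insert a s ha ih => rw [Finset.sum_insert ha, Finset.sum_insert ha, bohrFilter_add_op, ih]

lemma conjTranspose_bohrFilter (φ : ℝ → ℂ) (H A : Op Λ) :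
    (bohrFilter φ H A)ᴴ = bohrFilter (fun ν => star (φ (-ν))) H Aᴴ := by
  simp only [bohrFilter_eq_sum, Matrix.conjTranspose_sum, Matrix.conjTranspose_smul,
    Matrix.conjTranspose_mul, conjTranspose_eigenProj, neg_sub]
  rw [Finset.sum_comm]
  simp only [mul_assoc]

lemma specFun_mul_mul_specFun_eq_sum (f g : ℝ → ℂ) (H A : Op Λ) :
    specFun H f * A * specFun H g = ∑ E ∈ energies H, ∑ E' ∈ energies H,
      (f E * g E') • (eigenProj H E * A * eigenProj H E') := by
  rw [specFun, specFun, Finset.sum_mul, Finset.sum_mul]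
  refine Finset.sum_congr rfl fun E _ => ?_
  rw [Finset.mul_sum]
  refine Finset.sum_congr rfl fun E' _ => ?_
  rw [smul_mul_assoc, smul_mul_smul_comm]

lemma specFun_mul_mul_specFun (φ f g : ℝ → ℂ) (hfg : ∀ x y, φ (x - y) = f x * g y) (H A : Op Λ) :
    specFun H f * A * specFun H g = bohrFilter φ H A := by
  rw [bohrFilter_eq_sum, specFun_mul_mul_specFun_eq_sum]
  simp_rw [hfg]

lemma bohrFilter_ofReal {H : Op Λ} (hH : H.IsHermitian) (A : Op Λ) :
    bohrFilter (fun ν => (ν : ℂ)) H A = H * A - A * H := by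
  have : H * A - A * H = specFun H (fun x => (x : ℂ)) * A * specFun H (fun _ => 1)
      - specFun H (fun _ => 1) * A * specFun H (fun x => (x : ℂ)) := by
    rw [specFun_id hH, specFun_one hH]; simp
  rw [this, bohrFilter_eq_sum, specFun_mul_mul_specFun_eq_sum, specFun_mul_mul_specFun_eq_sum]
  simp_rw [← Finset.sum_sub_distrib, ← sub_smul]
  simp

/-- The symbol ν gives the commutator with H, which obeys the Leibniz rule. -/
lemma bohrFilter_ofReal_mul {H : Op Λ} (hH : H.IsHermitian) (A B : Op Λ) :
    bohrFilter (fun ν => (ν : ℂ)) H (A * B) =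
      bohrFilter (fun ν => (ν : ℂ)) H A * B + A * bohrFilter (fun ν => (ν : ℂ)) H B := by
  simp only [bohrFilter_ofReal hH]
  noncomm_ring

/-- An exponential of a difference factorises. Complex z covers Heisenberg evolution (z = it) and
conjugation by powers of the Gibbs state (z real) at once. -/
lemma bohrFilter_cexp (H A : Op Λ) (z : ℂ) :
    bohrFilter (fun ν => Complex.exp (z * ν)) H A =
      specFun H (fun x => Complex.exp (z * x)) * A * specFun H (fun x => Complex.exp (-z * x)) := by
  rw [specFun_mul_mul_specFun (fun ν => Complex.exp (z * ν))]
  intro x y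
  rw [← Complex.exp_add]
  push_cast
  ring_nf

lemma specFun_cexp_mul_neg {H : Op Λ} (hH : H.IsHermitian) (z : ℂ) :
    specFun H (fun x => Complex.exp (-z * x)) * specFun H (fun x => Complex.exp (z * x)) = 1 := by
  rw [specFun_mul, ← specFun_one hH]
  congr 1
  ext x
  rw [← Complex.exp_add]
  simp

lemma bohrFilter_cexp_mul {H : Op Λ} (hH : H.IsHermitian) (A B : Op Λ) (z : ℂ) :
    bohrFilter (fun ν => Complex.exp (z * ν)) H (A * B) =
      bohrFilter (fun ν => Complex.exp (z * ν)) H A *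
        bohrFilter (fun ν => Complex.exp (z * ν)) H B := by
  simp only [bohrFilter_cexp]
  have := specFun_cexp_mul_neg hH z
  calc _ = specFun H (fun x => Complex.exp (z * x)) * A * 1 * B *
        specFun H (fun x => Complex.exp (-z * x)) := by simp [mul_assoc]
    _ = _ := by rw [← this]; simp only [mul_assoc]

lemma exp_neg_smul_eq_cfc {H : Op Λ} (hH : H.IsHermitian) (β : ℝ) :
    NormedSpace.exp (-β • H) = cfc (fun x : ℝ => Real.exp (-β * x)) H := by
  have hH' : IsSelfAdjoint H := hH
  have h2 : IsSelfAdjoint (-β • H) := (IsSelfAdjoint.all (-β)).smul hH'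
  rw [← CFC.real_exp_eq_normedSpace_exp h2, ← cfc_comp_smul (-β) Real.exp H]
  · rfl

open scoped ComplexOrder in
lemma trace_exp_neg_smul {H : Op Λ} (hH : H.IsHermitian) (β : ℝ) :
    ∃ Z : ℝ, 0 < Z ∧ Matrix.trace (NormedSpace.exp (-β • H)) = (Z : ℂ) := by
  -- With B = e^{-βH/2} the trace is Tr B†B ≥ 0, and it vanishes only for B = 0, which is excluded
  -- because B is invertible.
  set B : Op Λ := cfc (fun x : ℝ => Real.exp (-β * x / 2)) H with hB
  have hBs : Bᴴ = B := cfc_predicate (p := IsSelfAdjoint) _ H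
  have h1 : NormedSpace.exp (-β • H) = Bᴴ * B := by
    rw [hBs, hB, exp_neg_smul_eq_cfc hH,
      ← cfc_mul _ _ _ (continuousOn_spectrum _ _) (continuousOn_spectrum _ _)]
    congr 1
    ext x
    rw [← Real.exp_add]
    ring_nf
  have h0 : 0 ≤ Matrix.trace (Bᴴ * B) := (Matrix.posSemidef_conjTranspose_mul_self B).trace_nonneg
  have hne : Matrix.trace (Bᴴ * B) ≠ 0 := by
    intro h
    rw [Matrix.trace_conjTranspose_mul_self_eq_zero_iff] at h
    have hH' : IsSelfAdjoint H := hH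
    have : B * cfc (fun x : ℝ => Real.exp (β * x / 2)) H = 1 := by
      rw [hB, ← cfc_mul _ _ _ (continuousOn_spectrum _ _) (continuousOn_spectrum _ _),
        ← cfc_const_one ℝ H]
      congr 1
      ext x
      rw [← Real.exp_add]
      ring_nf
      simp
    rw [h] at this
    simp at this
  rw [h1]
  have h3 := Complex.le_def.1 h0
  refine ⟨(Matrix.trace (Bᴴ * B)).re, lt_of_le_of_ne (by simpa using h3.1) ?_, ?_⟩
  · intro h
    exact hne (Complex.ext (by simpa using h.symm) (by simpa using h3.2.symm))
  · exact Complex.ext (by simp) (by simpa using h3.2.symm)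

lemma gibbsPow_eq_specFun {H : Op Λ} (hH : H.IsHermitian) (β : ℝ) :
    ∃ Z : ℝ, 0 < Z ∧ ∀ s : ℝ, gibbsPow β H s =
      (Z ^ s : ℝ) • specFun H (fun x => Complex.exp ((-β * s : ℝ) * x)) := by
  have hH' : IsSelfAdjoint H := hH
  obtain ⟨Z, hZ, hZ'⟩ := trace_exp_neg_smul hH β
  -- The witness is the inverse of the partition function, which is the normalisation of the Gibbs
  -- state.
  refine ⟨Z⁻¹, inv_pos.2 hZ, fun s => ?_⟩
  have h1 : gibbsState β H = cfc (fun x : ℝ => Z⁻¹ • Real.exp (-β * x)) H := by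
    rw [gibbsState, hZ', exp_neg_smul_eq_cfc hH, cfc_smul _ _ _ (continuousOn_spectrum _ _),
      ← Complex.ofReal_inv]
    ext i j; simp
  rw [gibbsPow, h1, ← cfc_comp' _ _ H (((Matrix.finite_real_spectrum (A := H)).image _).continuousOn _)
    (continuousOn_spectrum _ _) hH']
  have h2 : (fun x : ℝ => (Z⁻¹ • Real.exp (-β * x)) ^ s) =
      fun x : ℝ => (Z⁻¹ ^ s) • Real.exp ((-β * s) * x) := by
    ext x
    rw [smul_eq_mul, Real.mul_rpow (inv_pos.2 hZ).le (Real.exp_pos _).le, ← Real.exp_mul, smul_eq_mul]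
    ring_nf
  rw [h2, cfc_smul _ _ _ (continuousOn_spectrum _ _), ← specFun_ofReal hH]
  simp

lemma gibbsPow_mul_mul_gibbsPow {H : Op Λ} (hH : H.IsHermitian) (β s : ℝ) (A : Op Λ) :
    gibbsPow β H (-s) * A * gibbsPow β H s =
      bohrFilter (fun ν => Complex.exp ((β * s : ℝ) * ν)) H A := by
  obtain ⟨Z, hZ, h⟩ := gibbsPow_eq_specFun hH β
  rw [h, h, bohrFilter_cexp, smul_mul_assoc, smul_mul_assoc, mul_smul_comm, smul_smul,
    ← Real.rpow_add hZ]
  simp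

lemma gibbsPow_mul_gibbsPow_neg {H : Op Λ} (hH : H.IsHermitian) (β s : ℝ) :
    gibbsPow β H (-s) * gibbsPow β H s = 1 := by
  have := gibbsPow_mul_mul_gibbsPow hH β s 1
  rw [mul_one] at this
  rw [this, bohrFilter_cexp, mul_one]
  simpa using specFun_cexp_mul_neg hH (-((β * s : ℝ) : ℂ))

lemma conjTranspose_gibbsPow (H : Op Λ) (β s : ℝ) : (gibbsPow β H s)ᴴ = gibbsPow β H s :=
  cfc_predicate (p := IsSelfAdjoint) _ _

/-- On a finite spectrum every function agrees with its Lagrange interpolant, so f(H) is a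
polynomial in H. This is the source of all exact support statements. -/
lemma cfc_mem_of_mem (𝔸 : Subalgebra ℂ (Op Λ)) {H : Op Λ} (hH : H.IsHermitian) (hmem : H ∈ 𝔸)
    (f : ℝ → ℝ) : cfc f H ∈ 𝔸 := by
  have hH' : IsSelfAdjoint H := hH
  have h1 : cfc f H = cfc (Lagrange.interpolate (energies H) id f).eval H := by
    apply cfc_congr
    intro x hx
    have hx' : x ∈ energies H := by simpa [energies] using hx
    exact (Lagrange.eval_interpolate_at_node f (Set.injOn_id _) hx').symm
  rw [h1, cfc_polynomial _ H hH']
  have h2 : Algebra.adjoin ℝ {H} ≤ 𝔸.restrictScalars ℝ := Algebra.adjoin_le (by simpa using hmem)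
  exact h2 (Polynomial.aeval_mem_adjoin_singleton ℝ H)

lemma bohrFilter_mem (𝔸 : Subalgebra ℂ (Op Λ)) {H A : Op Λ} (hH : H.IsHermitian) (hmem : H ∈ 𝔸)
    (hA : A ∈ 𝔸) (φ : ℝ → ℂ) : bohrFilter φ H A ∈ 𝔸 := by
  rw [bohrFilter_eq_sum]
  exact Subalgebra.sum_mem _ fun E _ => Subalgebra.sum_mem _ fun E' _ => Subalgebra.smul_mem _
    (Subalgebra.mul_mem _ (Subalgebra.mul_mem _ (cfc_mem_of_mem 𝔸 hH hmem _) hA)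
      (cfc_mem_of_mem 𝔸 hH hmem _)) _

end Spectral

/-! ### Heisenberg evolution and Duhamel's formula. -/

section Dynamics

variable {Λ : Type} [Fintype Λ] [LinearOrder Λ]

/-- The propagator `e^{itH}`. -/
noncomputable def propagator (H : Op Λ) (t : ℝ) : Op Λ :=
  specFun H (fun x => Complex.exp ((Complex.I * t) * x))

/-- Heisenberg evolution `e^{itH} A e^{-itH}`. -/
noncomputable def evol (H : Op Λ) (t : ℝ) (A : Op Λ) : Op Λ :=
  bohrFilter (fun ν => Complex.exp ((Complex.I * t) * ν)) H A

lemma evol_eq (H : Op Λ) (t : ℝ) (A : Op Λ) :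
    evol H t A = propagator H t * A * propagator H (-t) := by
  rw [evol, bohrFilter_cexp]
  simp [propagator]

lemma propagator_zero {H : Op Λ} (hH : H.IsHermitian) : propagator H 0 = 1 := by
  simp [propagator, specFun_one hH]

lemma propagator_mul (H : Op Λ) (s t : ℝ) :
    propagator H s * propagator H t = propagator H (s + t) := by
  rw [propagator, propagator, specFun_mul, propagator]
  congr 1
  ext x
  rw [← Complex.exp_add]
  push_cast
  ring_nf

lemma conjTranspose_propagator (H : Op Λ) (t : ℝ) : (propagator H t)ᴴ = propagator H (-t) := by
  rw [propagator, conjTranspose_specFun, propagator]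
  congr 1
  ext x
  simp [← Complex.exp_conj]

lemma propagator_mem_unitary {H : Op Λ} (hH : H.IsHermitian) (t : ℝ) :
    propagator H t ∈ unitary (Op Λ) := by
  rw [Unitary.mem_iff, Matrix.star_eq_conjTranspose, conjTranspose_propagator, propagator_mul,
    propagator_mul]
  simp [propagator_zero hH]

lemma norm_evol {H : Op Λ} (hH : H.IsHermitian) (t : ℝ) (A : Op Λ) : ‖evol H t A‖ = ‖A‖ := by
  rw [evol_eq, CStarRing.norm_mul_mem_unitary _ (propagator_mem_unitary hH _),
    CStarRing.norm_mem_unitary_mul _ (propagator_mem_unitary hH _)]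

lemma evol_zero {H : Op Λ} (hH : H.IsHermitian) (A : Op Λ) : evol H 0 A = A := by
  simp [evol_eq, propagator_zero hH]

lemma evol_mul {H : Op Λ} (hH : H.IsHermitian) (t : ℝ) (A B : Op Λ) :
    evol H t (A * B) = evol H t A * evol H t B :=
  bohrFilter_cexp_mul hH A B _

lemma evol_add {H : Op Λ} (s t : ℝ) (A : Op Λ) : evol H s (evol H t A) = evol H (s + t) A := by
  simp only [evol_eq]
  rw [← propagator_mul, show -(s + t) = -t + -s by ring, ← propagator_mul]
  noncomm_ring

/-- The centralizer of X is a subalgebra containing H, hence it contains every function of H. -/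
lemma commute_propagator {H X : Op Λ} (hH : H.IsHermitian) (hX : Commute X H) (t : ℝ) :
    Commute X (propagator H t) := by
  have hmem : H ∈ Subalgebra.centralizer ℂ ({X} : Set (Op Λ)) := by
    rw [Subalgebra.mem_centralizer_iff]
    rintro _ rfl
    exact hX
  have : propagator H t ∈ Subalgebra.centralizer ℂ ({X} : Set (Op Λ)) :=
    Subalgebra.sum_mem _ fun E _ => Subalgebra.smul_mem _ (cfc_mem_of_mem _ hH hmem _) _
  rw [Subalgebra.mem_centralizer_iff] at this
  exact this X rfl

lemma hasDerivAt_propagator {H : Op Λ} (hH : H.IsHermitian) (t : ℝ) :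
    HasDerivAt (propagator H) (Complex.I • (H * propagator H t)) t := by
  have h1 : Complex.I • (H * propagator H t) = ∑ E ∈ energies H,
      (Complex.I * E * Complex.exp ((Complex.I * t) * E)) • eigenProj H E := by
    nth_rewrite 1 [← specFun_id hH]
    rw [propagator, specFun_mul, specFun, Finset.smul_sum]
    refine Finset.sum_congr rfl fun E _ => ?_
    rw [smul_smul, ← mul_assoc]
  rw [h1]
  unfold propagator specFun
  refine HasDerivAt.fun_sum fun E _ => HasDerivAt.smul_const ?_ _
  have h2 : HasDerivAt (fun t : ℝ => (Complex.I * t) * E) (Complex.I * E) t := by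
    have := ((Complex.ofRealCLM.hasDerivAt (x := t)).const_mul Complex.I).mul_const (E : ℂ)
    simpa using this
  convert! h2.cexp using 1
  ring

lemma continuous_propagator {H : Op Λ} (hH : H.IsHermitian) : Continuous (propagator H) :=
  continuous_iff_continuousAt.2 fun t => (hasDerivAt_propagator hH t).continuousAt

lemma continuous_evol {H : Op Λ} (hH : H.IsHermitian) (A : Op Λ) :
    Continuous fun t => evol H t A := by
  simp only [evol_eq]
  exact ((continuous_propagator hH).mul continuous_const).mul
    ((continuous_propagator hH).comp continuous_neg)

lemma commute_self_propagator {H : Op Λ} (hH : H.IsHermitian) (t : ℝ) :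
    H * propagator H t = propagator H t * H :=
  commute_propagator hH (Commute.refl H) t

/-- The path runs from the H₀-evolution of B at s = 0 to its H-evolution at s = t. Each Hamiltonian
commutes with its own propagator, so only the commutator with H - H₀ survives in the derivative.
With ε = ±1, negative times can be treated by integrals over [0, t]. -/
lemma hasDerivAt_interpolation {H H₀ : Op Λ} (hH : H.IsHermitian) (hH₀ : H₀.IsHermitian)
    (B : Op Λ) (ε t s : ℝ) :
    HasDerivAt (fun s => evol H₀ (ε * (t - s)) (evol H (ε * s) B))
      ((ε * Complex.I) • evol H₀ (ε * (t - s))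
        ((H - H₀) * evol H (ε * s) B - evol H (ε * s) B * (H - H₀))) s := by
  have d1 : HasDerivAt (fun s => ε * (t - s)) (-ε) s := by
    simpa using ((hasDerivAt_id s).const_sub t).const_mul ε
  have d2 : HasDerivAt (fun s => ε * s) ε s := by
    simpa using (hasDerivAt_id s).const_mul ε
  have e1 := (hasDerivAt_propagator hH₀ (ε * (t - s))).scomp s d1
  have e2 := (hasDerivAt_propagator hH (ε * s)).scomp s d2
  have e3 := (hasDerivAt_propagator hH (-(ε * s))).scomp s d2.neg
  have e4 := (hasDerivAt_propagator hH₀ (-(ε * (t - s)))).scomp s d1.neg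
  have := (((e1.mul e2).mul_const B).mul e3).mul e4
  simp only [evol_eq]
  convert! this using 1
  · ext1 s
    simp [mul_assoc]
  · simp only [Function.comp_apply, Pi.mul_apply, Pi.neg_apply]
    rw [commute_self_propagator hH₀ (ε * (t - s)), commute_self_propagator hH (-(ε * s))]
    have hs : ∀ (c : ℝ) (X : Op Λ), c • X = (c : ℂ) • X := fun c X => by ext; simp
    simp only [hs, smul_smul, smul_mul_assoc, mul_smul_comm]
    push_cast
    simp only [neg_neg, neg_mul, neg_smul]
    simp only [sub_mul, mul_sub, add_mul, smul_sub, neg_mul, smul_mul_assoc, ← mul_assoc]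
    abel

/-- Duhamel's bound for the difference of two Heisenberg evolutions. -/
lemma norm_evol_sub_evol_le {H H₀ : Op Λ} (hH : H.IsHermitian) (hH₀ : H₀.IsHermitian)
    (B : Op Λ) {ε : ℝ} (hε : |ε| = 1) {t : ℝ} (ht : 0 ≤ t) :
    ‖evol H (ε * t) B - evol H₀ (ε * t) B‖ ≤
      ∫ s in (0 : ℝ)..t, ‖(H - H₀) * evol H (ε * s) B - evol H (ε * s) B * (H - H₀)‖ := by
  set F' : ℝ → Op Λ := fun s => (ε * Complex.I) • evol H₀ (ε * (t - s))
        ((H - H₀) * evol H (ε * s) B - evol H (ε * s) B * (H - H₀)) with hF'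
  have hcont : Continuous F' := by
    have c1 : Continuous fun s => evol H (ε * s) B :=
      (continuous_evol hH B).comp (continuous_const.mul continuous_id)
    have c2 : Continuous fun s => propagator H₀ (ε * (t - s)) :=
      (continuous_propagator hH₀).comp (by fun_prop)
    have c3 : Continuous fun s => propagator H₀ (-(ε * (t - s))) :=
      (continuous_propagator hH₀).comp (by fun_prop)
    have c4 : Continuous fun s => evol H₀ (ε * (t - s))
        ((H - H₀) * evol H (ε * s) B - evol H (ε * s) B * (H - H₀)) := by
      simp only [evol_eq H₀]
      exact (c2.mul ((continuous_const.mul c1).sub (c1.mul continuous_const))).mul c3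
    exact c4.const_smul (ε * Complex.I)
  have h1 := intervalIntegral.integral_eq_sub_of_hasDerivAt
    (fun s _ => hasDerivAt_interpolation hH hH₀ B ε t s) (hcont.intervalIntegrable 0 t)
  have h2 : evol H (ε * t) B - evol H₀ (ε * t) B = ∫ s in (0 : ℝ)..t, F' s := by
    rw [h1]
    simp [evol_zero hH, evol_zero hH₀]
  rw [h2]
  refine (intervalIntegral.norm_integral_le_integral_norm ht).trans (le_of_eq ?_)
  refine intervalIntegral.integral_congr fun s _ => ?_
  simp only [hF']
  rw [norm_smul, norm_evol hH₀]
  simp [hε]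

/-- The growth of a commutator under the evolution is controlled by the part of the Hamiltonian
which does not commute with the fixed operator. -/
lemma norm_commutator_evol_le {H H₀ X : Op Λ} (hH : H.IsHermitian) (hH₀ : H₀.IsHermitian)
    (hX : Commute X H₀) (B : Op Λ) {ε : ℝ} (hε : |ε| = 1) {t : ℝ} (ht : 0 ≤ t) :
    ‖X * evol H (ε * t) B - evol H (ε * t) B * X‖ ≤ ‖X * B - B * X‖ +
      2 * ‖X‖ * ∫ s in (0 : ℝ)..t,
        ‖(H - H₀) * evol H (ε * s) B - evol H (ε * s) B * (H - H₀)‖ := by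
  set D := evol H (ε * t) B - evol H₀ (ε * t) B with hD
  -- X is invariant under the H₀-evolution, so this part keeps the norm of the initial commutator.
  have h0 : X * evol H₀ (ε * t) B - evol H₀ (ε * t) B * X = evol H₀ (ε * t) (X * B - B * X) := by
    have c1 := (commute_propagator hH₀ hX (ε * t)).eq
    have c2 := (commute_propagator hH₀ hX (-(ε * t))).eq
    simp only [evol_eq]
    rw [mul_assoc _ _ X, ← c2]
    simp only [← mul_assoc, mul_sub, sub_mul]
    rw [c1]
  have h1 : X * evol H (ε * t) B - evol H (ε * t) B * X =
      evol H₀ (ε * t) (X * B - B * X) + (X * D - D * X) := by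
    rw [← h0, hD]; noncomm_ring
  rw [h1]
  refine (norm_add_le _ _).trans ?_
  rw [norm_evol hH₀]
  gcongr
  calc ‖X * D - D * X‖ ≤ ‖X‖ * ‖D‖ + ‖D‖ * ‖X‖ :=
        (norm_sub_le _ _).trans (add_le_add (norm_mul_le _ _) (norm_mul_le _ _))
    _ = 2 * ‖X‖ * ‖D‖ := by ring
    _ ≤ _ := by gcongr; exact norm_evol_sub_evol_le hH hH₀ B hε ht

end Dynamics

/-! ### Grönwall's inequality and rearrangements of sums over interaction supports. -/

/-- The integral form of Grönwall's inequality. -/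
lemma le_mul_exp_of_le_add_integral {W : ℝ → ℝ} (hW : Continuous W) {a c : ℝ} (hc : 0 ≤ c)
    (h : ∀ t, 0 ≤ t → W t ≤ a + c * ∫ s in (0 : ℝ)..t, W s) {t : ℝ} (ht : 0 ≤ t) :
    W t ≤ a * Real.exp (c * t) := by
  set V : ℝ → ℝ := fun t => a + c * ∫ s in (0 : ℝ)..t, W s with hV
  have hd : ∀ t, HasDerivAt V (c * W t) t := fun t =>
    ((hW.integral_hasStrictDerivAt 0 t).hasDerivAt.const_mul c).const_add a
  have hVc : Continuous V := continuous_iff_continuousAt.2 fun t => (hd t).continuousAt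
  have := le_gronwallBound_of_liminf_deriv_right_le (f := V) (f' := fun t => c * W t) (δ := a)
    (K := c) (ε := 0) (a := 0) (b := t) hVc.continuousOn
    (fun x _ r hr => (hd x).hasDerivWithinAt.liminf_right_slope_le hr) (by simp [hV])
    (fun x hx => by
      rw [add_zero]
      exact mul_le_mul_of_nonneg_left (h x hx.1) hc) t ⟨ht, le_rfl⟩
  rw [sub_zero, gronwallBound_ε0] at this
  exact (h t ht).trans this

/-- Exchanging the sums turns an estimate spread over the sites of each Z into one over pairs x, y,
which is the form in which the decay hypothesis can be applied. -/
lemma sum_filter_mem_mul_sum {Λ : Type} [Fintype Λ] [DecidableEq Λ] (w u : Λ → ℝ)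
    (a : Finset Λ → ℝ) :
    ∑ x, w x * ∑ Z ∈ Finset.univ.filter (fun Z : Finset Λ => x ∈ Z), a Z * ∑ y ∈ Z, u y =
      ∑ y, u y * ∑ x, w x * ∑ Z ∈ Finset.univ.filter (fun Z : Finset Λ => x ∈ Z ∧ y ∈ Z), a Z := by
  have h1 : ∀ x, w x * ∑ Z ∈ Finset.univ.filter (fun Z : Finset Λ => x ∈ Z), a Z * ∑ y ∈ Z, u y =
      ∑ y, ∑ Z : Finset Λ, if x ∈ Z ∧ y ∈ Z then u y * (w x * a Z) else 0 := by
    intro x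
    rw [Finset.sum_comm, Finset.sum_filter, Finset.mul_sum]
    refine Finset.sum_congr rfl fun Z _ => ?_
    by_cases hx : x ∈ Z
    · simp only [hx, if_true, true_and, ← Finset.sum_filter, Finset.mul_sum]
      rw [Finset.filter_mem_eq_inter, Finset.univ_inter]
      exact Finset.sum_congr rfl fun y _ => by ring
    · simp [hx]
  simp_rw [h1]
  rw [Finset.sum_comm]
  refine Finset.sum_congr rfl fun y _ => ?_
  rw [Finset.mul_sum]
  refine Finset.sum_congr rfl fun x _ => ?_
  rw [Finset.sum_filter, Finset.mul_sum, Finset.mul_sum]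
  refine Finset.sum_congr rfl fun Z _ => ?_
  split_ifs <;> simp

lemma sum_filter_le_sum_sum {Λ : Type} [Fintype Λ] [DecidableEq Λ] (p : Finset Λ → Prop)
    [DecidablePred p] (s : Finset Λ) (hp : ∀ Z, p Z → ∃ x ∈ s, x ∈ Z) (g : Finset Λ → ℝ)
    (hg : ∀ Z, 0 ≤ g Z) :
    ∑ Z ∈ Finset.univ.filter p, g Z ≤
      ∑ x ∈ s, ∑ Z ∈ Finset.univ.filter (fun Z : Finset Λ => x ∈ Z), g Z := by
  simp_rw [Finset.sum_filter]
  rw [Finset.sum_comm]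
  refine Finset.sum_le_sum fun Z _ => ?_
  have hnn : ∀ x ∈ s, 0 ≤ if x ∈ Z then g Z else 0 := fun x _ => by
    split_ifs <;> simp [hg]
  split_ifs with h
  · obtain ⟨x, hx, hxZ⟩ := hp Z h
    calc g Z = if x ∈ Z then g Z else 0 := by simp [hxZ]
      _ ≤ _ := Finset.single_le_sum hnn hx
  · exact Finset.sum_nonneg hnn

lemma isHermitian_sum {ι n : Type} (s : Finset ι) {h : ι → Matrix n n ℂ} (hh : ∀ i, (h i).IsHermitian) :
    (∑ i ∈ s, h i).IsHermitian := by
  rw [Matrix.IsHermitian, Matrix.conjTranspose_sum]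
  exact Finset.sum_congr rfl fun i _ => hh i

/-! ### The Lieb-Robinson bound and truncation of the dynamics. -/

section LiebRobinson

variable {Λ : Type} [Fintype Λ] [LinearOrder Λ]

/-- The norm of the commutator of `X` with the evolved operator `A`. -/
noncomputable def commNorm (H A X : Op Λ) (t : ℝ) : ℝ := ‖X * evol H t A - evol H t A * X‖

lemma continuous_commNorm {H : Op Λ} (hH : H.IsHermitian) (A X : Op Λ) (ε : ℝ) :
    Continuous fun s => commNorm H A X (ε * s) := by
  have c1 : Continuous fun s => evol H (ε * s) A :=
    (continuous_evol hH A).comp (continuous_const.mul continuous_id)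
  exact ((continuous_const.mul c1).sub (c1.mul continuous_const)).norm

lemma commNorm_nonneg (H A X : Op Λ) (t : ℝ) : 0 ≤ commNorm H A X t := norm_nonneg _

lemma commNorm_sum_le {ι : Type} (s : Finset ι) (H A : Op Λ) (h : ι → Op Λ) (t : ℝ) :
    commNorm H A (∑ i ∈ s, h i) t ≤ ∑ i ∈ s, commNorm H A (h i) t := by
  unfold commNorm
  rw [Finset.sum_mul, Finset.mul_sum, ← Finset.sum_sub_distrib]
  exact norm_sum_le _ _

/-- A weighted sum of commutators of all interaction terms with the evolved operator. -/
noncomputable def weightedComm (h : Finset Λ → Op Λ) (A : Op Λ) (w : Λ → ℝ) (t : ℝ) : ℝ :=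
  ∑ x, w x * ∑ Z ∈ Finset.univ.filter (fun Z : Finset Λ => x ∈ Z), commNorm (∑ I, h I) A (h Z) t

/-- The Lieb-Robinson bound in weighted form. -/
lemma weightedComm_le {h : Finset Λ → Op Λ} (hh : ∀ I, (h I).IsHermitian)
    (hcomm : ∀ Z Z', Disjoint Z Z' → Commute (h Z) (h Z')) {A : Op Λ} {S : Finset Λ}
    (hA : ∀ Z, Disjoint Z S → Commute (h Z) A) {w : Λ → ℝ} (hw : ∀ x, 0 ≤ w x) {k : ℝ}
    (hk : 0 ≤ k)
    (hwk : ∀ y, ∑ x, w x * ∑ Z ∈ Finset.univ.filter (fun Z : Finset Λ => x ∈ Z ∧ y ∈ Z), ‖h Z‖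
      ≤ k * w y)
    {ε : ℝ} (hε : |ε| = 1) {t : ℝ} (ht : 0 ≤ t) :
    weightedComm h A w (ε * t) ≤ 2 * ‖A‖ * k * (∑ y ∈ S, w y) * Real.exp (2 * k * t) := by
  set H := ∑ I, h I with hHdef
  have hH : H.IsHermitian := isHermitian_sum _ hh
  have hcontg : ∀ y, Continuous fun s => ∑ Z ∈ Finset.univ.filter (fun Z : Finset Λ => y ∈ Z),
      commNorm H A (h Z) (ε * s) := fun y =>
    continuous_finsetSum _ fun Z _ => continuous_commNorm hH A (h Z) ε
  have hg0 : ∀ y s, 0 ≤ ∑ Z ∈ Finset.univ.filter (fun Z : Finset Λ => y ∈ Z),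
      commNorm H A (h Z) (ε * s) := fun y s =>
    Finset.sum_nonneg fun Z _ => commNorm_nonneg _ _ _ _
  -- The reference Hamiltonian keeps the terms disjoint from Z, all of which commute with `h Z`.
  -- Each remaining term meets Z and is charged to the sites of Z.
  have step : ∀ Z t, 0 ≤ t → commNorm H A (h Z) (ε * t) ≤
      ‖h Z‖ * ∑ y ∈ Z, ((if y ∈ S then 2 * ‖A‖ else 0) + 2 * ∫ s in (0 : ℝ)..t,
        ∑ Z' ∈ Finset.univ.filter (fun Z' : Finset Λ => y ∈ Z'),
          commNorm H A (h Z') (ε * s)) := by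
    intro Z t ht
    set H₀ := ∑ Z' ∈ Finset.univ.filter (fun Z' : Finset Λ => Disjoint Z Z'), h Z' with hH₀def
    have hH₀ : H₀.IsHermitian := isHermitian_sum _ hh
    have hX : Commute (h Z) H₀ :=
      Commute.sum_right _ _ _ fun Z' hZ' => hcomm Z Z' (Finset.mem_filter.1 hZ').2
    have hsub : H - H₀ = ∑ Z' ∈ Finset.univ.filter (fun Z' : Finset Λ => ¬ Disjoint Z Z'), h Z' := by
      rw [hHdef, ← Finset.sum_filter_add_sum_filter_not Finset.univ
        (fun Z' : Finset Λ => Disjoint Z Z') h]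
      simp [hH₀def]
    have h1 := norm_commutator_evol_le hH hH₀ hX A hε ht
    have h2 : ‖h Z * A - A * h Z‖ ≤ ‖h Z‖ * ∑ y ∈ Z, (if y ∈ S then 2 * ‖A‖ else 0) := by
      have hn : ∀ y ∈ Z, (0 : ℝ) ≤ if y ∈ S then 2 * ‖A‖ else 0 := fun y _ => by
        split_ifs <;> positivity
      by_cases hd : Disjoint Z S
      · rw [(hA Z hd).eq, sub_self, norm_zero]
        exact mul_nonneg (norm_nonneg _) (Finset.sum_nonneg hn)
      · obtain ⟨y, hyZ, hyS⟩ := Finset.not_disjoint_iff.1 hd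
        calc ‖h Z * A - A * h Z‖ ≤ ‖h Z‖ * ‖A‖ + ‖A‖ * ‖h Z‖ :=
              (norm_sub_le _ _).trans (add_le_add (norm_mul_le _ _) (norm_mul_le _ _))
          _ = ‖h Z‖ * (if y ∈ S then 2 * ‖A‖ else 0) := by simp [hyS]; ring
          _ ≤ _ := by
            gcongr
            exact Finset.single_le_sum hn hyZ
    have h3 : ∫ s in (0 : ℝ)..t, ‖(H - H₀) * evol H (ε * s) A - evol H (ε * s) A * (H - H₀)‖ ≤
        ∑ y ∈ Z, ∫ s in (0 : ℝ)..t, ∑ Z' ∈ Finset.univ.filter (fun Z' : Finset Λ => y ∈ Z'),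
          commNorm H A (h Z') (ε * s) := by
      rw [← intervalIntegral.integral_finsetSum fun y _ => (hcontg y).intervalIntegrable _ _]
      refine intervalIntegral.integral_mono_on ht
        ((continuous_commNorm hH A (H - H₀) ε).intervalIntegrable _ _)
        ((continuous_finsetSum _ fun y _ => hcontg y).intervalIntegrable _ _) fun s _ => ?_
      rw [hsub]
      refine (commNorm_sum_le _ H A h (ε * s)).trans ?_
      exact sum_filter_le_sum_sum _ Z (fun Z' hZ' => Finset.not_disjoint_iff.1 hZ') _
        fun Z' => commNorm_nonneg _ _ _ _
    rw [Finset.sum_add_distrib, mul_add, ← Finset.mul_sum]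
    refine h1.trans (add_le_add h2 ?_)
    calc _ ≤ 2 * ‖h Z‖ * ∑ y ∈ Z, ∫ s in (0 : ℝ)..t,
          ∑ Z' ∈ Finset.univ.filter (fun Z' : Finset Λ => y ∈ Z'), commNorm H A (h Z') (ε * s) := by
          gcongr
      _ = _ := by ring
  -- After the sums are exchanged, `hwk` reproduces the weight at y, so the weighted sum satisfies a
  -- closed Grönwall inequality.
  have main : ∀ t, 0 ≤ t → weightedComm h A w (ε * t) ≤ 2 * ‖A‖ * k * (∑ y ∈ S, w y) +
      (2 * k) * ∫ s in (0 : ℝ)..t, weightedComm h A w (ε * s) := by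
    intro t ht
    set u : Λ → ℝ := fun y => (if y ∈ S then 2 * ‖A‖ else 0) + 2 * ∫ s in (0 : ℝ)..t,
        ∑ Z' ∈ Finset.univ.filter (fun Z' : Finset Λ => y ∈ Z'), commNorm H A (h Z') (ε * s) with hu
    have hu0 : ∀ y, 0 ≤ u y := fun y => by
      have : 0 ≤ ∫ s in (0 : ℝ)..t, ∑ Z' ∈ Finset.univ.filter (fun Z' : Finset Λ => y ∈ Z'),
          commNorm H A (h Z') (ε * s) :=
        intervalIntegral.integral_nonneg ht fun s _ => hg0 y s
      simp only [hu]
      split_ifs <;> positivity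
    calc weightedComm h A w (ε * t) ≤ ∑ x, w x *
          ∑ Z ∈ Finset.univ.filter (fun Z : Finset Λ => x ∈ Z), ‖h Z‖ * ∑ y ∈ Z, u y := by
          unfold weightedComm
          gcongr with x _ Z _
          · exact hw x
          · exact step Z t ht
      _ = ∑ y, u y * ∑ x, w x *
          ∑ Z ∈ Finset.univ.filter (fun Z : Finset Λ => x ∈ Z ∧ y ∈ Z), ‖h Z‖ :=
          sum_filter_mem_mul_sum _ _ _
      _ ≤ ∑ y, u y * (k * w y) := by
          gcongr with y _
          · exact hu0 y
          · exact hwk y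
      _ = _ := by
          have hint : ∫ s in (0 : ℝ)..t, weightedComm h A w (ε * s) = ∑ y, w y *
              ∫ s in (0 : ℝ)..t, ∑ Z' ∈ Finset.univ.filter (fun Z' : Finset Λ => y ∈ Z'),
                commNorm H A (h Z') (ε * s) := by
            unfold weightedComm
            rw [intervalIntegral.integral_finsetSum
              fun y _ => ((hcontg y).const_mul (w y)).intervalIntegrable _ _]
            simp
          rw [hint, Finset.mul_sum, Finset.mul_sum]
          have hS : ∑ y ∈ S, 2 * ‖A‖ * k * w y = ∑ y, if y ∈ S then 2 * ‖A‖ * k * w y else 0 := by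
            rw [← Finset.sum_filter, Finset.filter_mem_eq_inter, Finset.univ_inter]
          rw [hS, ← Finset.sum_add_distrib]
          refine Finset.sum_congr rfl fun y _ => ?_
          simp only [hu]
          split_ifs <;> ring
  refine le_mul_exp_of_le_add_integral (W := fun t => weightedComm h A w (ε * t)) ?_
    (by positivity) main ht
  exact continuous_finsetSum _ fun x _ => (hcontg x).const_mul (w x)

/-- The evolutions under the full and the truncated Hamiltonian stay close to each other. -/
lemma norm_evol_sub_evol_truncated_le {h : Finset Λ → Op Λ} (hh : ∀ I, (h I).IsHermitian)
    (hcomm : ∀ Z Z', Disjoint Z Z' → Commute (h Z) (h Z')) {A : Op Λ} {S : Finset Λ}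
    (hA : ∀ Z, Disjoint Z S → Commute (h Z) A) {w : Λ → ℝ} (hw : ∀ x, 0 ≤ w x) {k : ℝ}
    (hk : 0 ≤ k)
    (hwk : ∀ y, ∑ x, w x * ∑ Z ∈ Finset.univ.filter (fun Z : Finset Λ => x ∈ Z ∧ y ∈ Z), ‖h Z‖
      ≤ k * w y) {Ω : Finset Λ} {q : ℝ} (hq : 0 ≤ q) (hΩ : ∀ x, x ∉ Ω → 1 ≤ q * w x) (t : ℝ) :
    ‖evol (∑ I, h I) t A - evol (truncatedHam h Ω) t A‖ ≤
      q * (2 * ‖A‖ * k * (∑ y ∈ S, w y)) * Real.exp ((2 * k + 1) * |t|) := by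
  obtain ⟨ε, hε, hεt⟩ : ∃ ε : ℝ, |ε| = 1 ∧ ε * |t| = t := by
    rcases le_total 0 t with h0 | h0
    · exact ⟨1, by simp, by simp [abs_of_nonneg h0]⟩
    · exact ⟨-1, by simp, by simp [abs_of_nonpos h0]⟩
  set H := ∑ I, h I with hHdef
  have hH : H.IsHermitian := isHermitian_sum _ hh
  have hH₀ : (truncatedHam h Ω).IsHermitian := isHermitian_sum _ hh
  have hsub : H - truncatedHam h Ω =
      ∑ Z ∈ Finset.univ.filter (fun Z : Finset Λ => ¬ Z ⊆ Ω), h Z := by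
    rw [hHdef, ← Finset.sum_filter_add_sum_filter_not Finset.univ (fun Z : Finset Λ => Z ⊆ Ω) h,
      truncatedHam]
    simp
  have h1 := norm_evol_sub_evol_le hH hH₀ A hε (abs_nonneg t)
  rw [hεt] at h1
  refine h1.trans ?_
  set a := 2 * ‖A‖ * k * (∑ y ∈ S, w y) with ha
  have ha0 : 0 ≤ a := by
    have : 0 ≤ ∑ y ∈ S, w y := Finset.sum_nonneg fun y _ => hw y
    positivity
  -- Every discarded term contains a site outside Ω, where q w ≥ 1; the discarded commutators are
  -- thus at most q times the weighted sum.
  have hb : ∀ s ∈ Set.Icc (0 : ℝ) |t|,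
      ‖(H - truncatedHam h Ω) * evol H (ε * s) A - evol H (ε * s) A * (H - truncatedHam h Ω)‖ ≤
        q * a * Real.exp (2 * k * |t|) := by
    intro s hs
    rw [hsub]
    calc _ ≤ ∑ Z ∈ Finset.univ.filter (fun Z : Finset Λ => ¬ Z ⊆ Ω), commNorm H A (h Z) (ε * s) :=
          commNorm_sum_le _ H A h (ε * s)
      _ ≤ ∑ x ∈ Finset.univ.filter (fun x => x ∉ Ω),
          ∑ Z ∈ Finset.univ.filter (fun Z : Finset Λ => x ∈ Z), commNorm H A (h Z) (ε * s) := by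
          refine sum_filter_le_sum_sum _ _ (fun Z hZ => ?_) _ fun Z => commNorm_nonneg _ _ _ _
          obtain ⟨x, hx, hx'⟩ := Finset.not_subset.1 hZ
          exact ⟨x, by simp [hx'], hx⟩
      _ ≤ ∑ x ∈ Finset.univ.filter (fun x => x ∉ Ω), q * (w x *
          ∑ Z ∈ Finset.univ.filter (fun Z : Finset Λ => x ∈ Z), commNorm H A (h Z) (ε * s)) := by
          refine Finset.sum_le_sum fun x hx => ?_
          rw [← mul_assoc]
          exact le_mul_of_one_le_left (Finset.sum_nonneg fun Z _ => commNorm_nonneg _ _ _ _)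
            (hΩ x (Finset.mem_filter.1 hx).2)
      _ ≤ ∑ x, q * (w x *
          ∑ Z ∈ Finset.univ.filter (fun Z : Finset Λ => x ∈ Z), commNorm H A (h Z) (ε * s)) := by
          refine Finset.sum_le_sum_of_subset_of_nonneg (Finset.filter_subset _ _) fun x _ _ => ?_
          exact mul_nonneg hq (mul_nonneg (hw x) (Finset.sum_nonneg fun Z _ => commNorm_nonneg _ _ _ _))
      _ = q * weightedComm h A w (ε * s) := by rw [weightedComm, Finset.mul_sum]
      _ ≤ q * (a * Real.exp (2 * k * s)) := by
          gcongr
          exact weightedComm_le hh hcomm hA hw hk hwk hε hs.1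
      _ ≤ q * (a * Real.exp (2 * k * |t|)) := by
          gcongr
          exact hs.2
      _ = _ := by ring
  have h2 := intervalIntegral.integral_mono_on (μ := MeasureTheory.volume) (abs_nonneg t)
    ((continuous_commNorm hH A (H - truncatedHam h Ω) ε).intervalIntegrable 0 |t|)
    intervalIntegrable_const hb
  refine h2.trans ?_
  rw [intervalIntegral.integral_const, sub_zero, smul_eq_mul]
  -- The length of the time interval is absorbed into e^{|t|}, which accounts for the +1 in the
  -- growth rate.
  have h3 : |t| ≤ Real.exp |t| := (by linarith : |t| ≤ |t| + 1).trans (Real.add_one_le_exp _)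
  calc |t| * (q * a * Real.exp (2 * k * |t|)) ≤
        Real.exp |t| * (q * a * Real.exp (2 * k * |t|)) := by gcongr
    _ = _ := by
      rw [show (2 * k + 1) * |t| = |t| + 2 * k * |t| by ring, Real.exp_add]; ring

end LiebRobinson

/-! ### Tensor product supports for qubits. -/

section Qubit

variable {Λ : Type} [Fintype Λ] [LinearOrder Λ]

open scoped Kronecker in
/-- The operator `B ⊗ 1` with `B` acting on the qubits in `I`. -/
def qubitEmbed (I : Finset Λ) (B : Matrix (I → Bool) (I → Bool) ℂ) : Op Λ :=
  (B ⊗ₖ (1 : Matrix ({j // j ∉ I} → Bool) ({j // j ∉ I} → Bool) ℂ)).submatrix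
    (Equiv.piEquivPiSubtypeProd (fun j => j ∈ I) fun _ => Bool)
    (Equiv.piEquivPiSubtypeProd (fun j => j ∈ I) fun _ => Bool)

open scoped Kronecker in
/-- The operator `1 ⊗ B` with `B` acting on the qubits outside `I`. -/
def qubitEmbedCompl (I : Finset Λ) (B : Matrix ({j // j ∉ I} → Bool) ({j // j ∉ I} → Bool) ℂ) :
    Op Λ :=
  ((1 : Matrix (I → Bool) (I → Bool) ℂ) ⊗ₖ B).submatrix
    (Equiv.piEquivPiSubtypeProd (fun j => j ∈ I) fun _ => Bool)
    (Equiv.piEquivPiSubtypeProd (fun j => j ∈ I) fun _ => Bool)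

lemma qubitEmbed_apply (I : Finset Λ) (B : Matrix (I → Bool) (I → Bool) ℂ) (x y : Λ → Bool) :
    qubitEmbed I B x y =
      if ∀ j : Λ, j ∉ I → x j = y j then B (fun i => x i) (fun i => y i) else 0 := by
  simp only [qubitEmbed, Matrix.submatrix_apply, Equiv.piEquivPiSubtypeProd,
    Equiv.coe_fn_mk, Matrix.kronecker_apply, Matrix.one_apply, funext_iff, Subtype.forall]
  split_ifs <;> simp

lemma qubitEmbedCompl_apply (I : Finset Λ)
    (B : Matrix ({j // j ∉ I} → Bool) ({j // j ∉ I} → Bool) ℂ) (x y : Λ → Bool) :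
    qubitEmbedCompl I B x y =
      if ∀ j : Λ, j ∈ I → x j = y j then B (fun i => x i) (fun i => y i) else 0 := by
  simp only [qubitEmbedCompl, Matrix.submatrix_apply, Equiv.piEquivPiSubtypeProd,
    Equiv.coe_fn_mk, Matrix.kronecker_apply, Matrix.one_apply, funext_iff, Subtype.forall]
  split_ifs <;> simp

lemma isSupportedOn_qubit_iff (I : Finset Λ) (A : Op Λ) :
    IsSupportedOn SystemKind.qubit I A ↔ ∃ B, A = qubitEmbed I B := by
  refine exists_congr fun B => ⟨fun h => ?_, fun h => ?_⟩
  · ext x y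
    rw [h, qubitEmbed_apply]
  · intro x y
    rw [h, qubitEmbed_apply]

lemma qubitEmbed_mul (I : Finset Λ) (B C : Matrix (I → Bool) (I → Bool) ℂ) :
    qubitEmbed I B * qubitEmbed I C = qubitEmbed I (B * C) := by
  rw [qubitEmbed, qubitEmbed, Matrix.submatrix_mul_equiv, ← Matrix.mul_kronecker_mul, one_mul,
    qubitEmbed]

lemma qubitEmbed_one (I : Finset Λ) : qubitEmbed I 1 = 1 := by
  rw [qubitEmbed, Matrix.one_kronecker_one, Matrix.submatrix_one_equiv]

lemma commute_qubitEmbed_compl (I : Finset Λ) (B : Matrix (I → Bool) (I → Bool) ℂ)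
    (C : Matrix ({j // j ∉ I} → Bool) ({j // j ∉ I} → Bool) ℂ) :
    Commute (qubitEmbed I B) (qubitEmbedCompl I C) := by
  rw [Commute, SemiconjBy, qubitEmbed, qubitEmbedCompl, Matrix.submatrix_mul_equiv,
    Matrix.submatrix_mul_equiv, ← Matrix.mul_kronecker_mul, ← Matrix.mul_kronecker_mul]
  simp

lemma exists_qubitEmbed_of_subset {I J : Finset Λ} (hIJ : I ⊆ J)
    (B : Matrix (I → Bool) (I → Bool) ℂ) : ∃ C, qubitEmbed I B = qubitEmbed J C := by
  -- The witness is B tensored with the identity on J \ I.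
  refine ⟨Matrix.of fun u v => if ∀ j : J, j.1 ∉ I → u j = v j then
    B (fun i => u ⟨i, hIJ i.2⟩) (fun i => v ⟨i, hIJ i.2⟩) else 0, ?_⟩
  ext x y
  rw [qubitEmbed_apply, qubitEmbed_apply, Matrix.of_apply, ← ite_and]
  congr 1
  simp only [Subtype.forall, eq_iff_iff]
  constructor
  · exact fun h => ⟨fun j hj => h j fun hj' => hj (hIJ hj'), fun j _ hj => h j hj⟩
  · rintro ⟨h1, h2⟩ j hj
    by_cases hJ : j ∈ J
    · exact h2 j hJ hj
    · exact h1 j hJ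

lemma exists_qubitEmbedCompl_of_disjoint {I J : Finset Λ} (hIJ : Disjoint I J)
    (B : Matrix (J → Bool) (J → Bool) ℂ) : ∃ C, qubitEmbed J B = qubitEmbedCompl I C := by
  have hJ : ∀ {j}, j ∈ J → j ∉ I := fun hj hj' => Finset.disjoint_left.1 hIJ hj' hj
  refine ⟨Matrix.of fun u v => if ∀ j : {j // j ∉ I}, j.1 ∉ J → u j = v j then
    B (fun i => u ⟨i, hJ i.2⟩) (fun i => v ⟨i, hJ i.2⟩) else 0, ?_⟩
  ext x y
  rw [qubitEmbed_apply, qubitEmbedCompl_apply, Matrix.of_apply, ← ite_and]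
  congr 1
  simp only [Subtype.forall, eq_iff_iff]
  constructor
  · exact fun h => ⟨fun j hj => h j fun hj' => hJ hj' hj, fun j _ hj => h j hj⟩
  · rintro ⟨h1, h2⟩ j hj
    by_cases hI : j ∈ I
    · exact h1 j hI
    · exact h2 j hI hj

end Qubit

/-! ### Monomial matrices and Jordan-Wigner signs. -/

section OccupationSign

variable {Λ : Type} [Fintype Λ]

/-- The matrix with one nonzero entry `c y` in each column `y`, in row `f y`. -/
def monomialMatrix (f : (Λ → Bool) → Λ → Bool) (c : (Λ → Bool) → ℂ) : Op Λ :=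
  fun x y => if x = f y then c y else 0

/-- The sign `(-1) ^ #{j | P j ∧ y j = 1}`. -/
noncomputable def occSign (P : Λ → Prop) [DecidablePred P] (y : Λ → Bool) : ℂ :=
  (-1 : ℂ) ^ (Finset.univ.filter (fun j : Λ => P j ∧ y j = true)).card

lemma occSign_eq_prod (P : Λ → Prop) [DecidablePred P] (y : Λ → Bool) :
    occSign P y = ∏ j, if P j ∧ y j = true then (-1 : ℂ) else 1 := by
  rw [occSign, Finset.prod_ite]
  simp

lemma occSign_mul_self (P : Λ → Prop) [DecidablePred P] (y : Λ → Bool) :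
    occSign P y * occSign P y = 1 := by
  rw [occSign, ← pow_add, ← two_mul, pow_mul]
  simp

lemma parityOp_eq_monomialMatrix :
    (parityOp : Op Λ) = monomialMatrix id (occSign fun _ => True) := by
  ext x y
  simp only [parityOp, monomialMatrix, Matrix.diagonal_apply, occSign, id, true_and]
  split_ifs with h
  · rw [h]
  · rfl

end OccupationSign

/-! ### Anticommutation of ladder operators and parity. -/

section Fermion

variable {Λ : Type} [Fintype Λ] [LinearOrder Λ]

lemma monomialMatrix_mul (f g : (Λ → Bool) → Λ → Bool) (c d : (Λ → Bool) → ℂ) :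
    monomialMatrix f c * monomialMatrix g d = monomialMatrix (f ∘ g) fun y => c (g y) * d y := by
  ext x y
  simp [monomialMatrix, Matrix.mul_apply]

lemma occSign_update_of_not (P : Λ → Prop) [DecidablePred P] (y : Λ → Bool) {i : Λ} (hi : ¬ P i)
    (b : Bool) : occSign P (Function.update y i b) = occSign P y := by
  rw [occSign_eq_prod, occSign_eq_prod]
  refine Finset.prod_congr rfl fun j _ => ?_
  by_cases h : j = i
  · subst h; simp [hi]
  · simp [h]

lemma occSign_update (P : Λ → Prop) [DecidablePred P] (y : Λ → Bool) {i : Λ} (hi : P i)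
    {b : Bool} (hy : y i = !b) : occSign P (Function.update y i b) = -occSign P y := by
  rw [occSign_eq_prod, occSign_eq_prod, ← Finset.mul_prod_erase _ _ (Finset.mem_univ i),
    ← Finset.mul_prod_erase Finset.univ (fun j => if P j ∧ y j = true then (-1 : ℂ) else 1)
      (Finset.mem_univ i), ← neg_mul]
  congr 1
  · cases b <;> simp [hi, hy]
  · refine Finset.prod_congr rfl fun j hj => ?_
    simp [Finset.ne_of_mem_erase hj]

/-- The annihilation operator (`b = false`) or creation operator (`b = true`) of the mode `i`. -/
noncomputable def ladderOp (i : Λ) (b : Bool) : Op Λ :=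
  monomialMatrix (fun y => Function.update y i b)
    fun y => if y i = !b then occSign (fun j => j < i) y else 0

lemma annihilation_eq_ladderOp (i : Λ) : annihilation i = ladderOp i false := by
  ext x y
  simp only [annihilation, ladderOp, monomialMatrix, occSign]
  by_cases h1 : y i = true <;> by_cases h2 : x = Function.update y i false <;> simp [h1, h2]

lemma conjTranspose_annihilation_eq_ladderOp (i : Λ) : (annihilation i)ᴴ = ladderOp i true := by
  ext x y
  rw [Matrix.conjTranspose_apply, annihilation_eq_ladderOp]
  simp only [ladderOp, monomialMatrix]
  have hiff : (y = Function.update x i false ∧ x i = true) ↔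
      (x = Function.update y i true ∧ y i = false) := by
    constructor
    · rintro ⟨rfl, h⟩
      simp [← h]
    · rintro ⟨rfl, h⟩
      simp [← h]
  by_cases h : x = Function.update y i true ∧ y i = false
  · obtain ⟨h1, h2⟩ := hiff.2 h
    have hs : occSign (fun j => j < i) x = occSign (fun j => j < i) y := by
      rw [h.1, occSign_update_of_not (fun j => j < i) y (lt_irrefl i)]
    rw [if_pos h1, if_pos h.1, if_pos (by simpa using h2), if_pos (by simpa using h.2), hs]
    simp [occSign]
  · have h' := mt hiff.1 h
    have e1 : (if x = Function.update y i true then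
        if y i = !true then occSign (fun j => j < i) y else 0 else 0) = 0 := by
      rw [← ite_and, if_neg (by simpa using h)]
    have e2 : (if y = Function.update x i false then
        if x i = !false then occSign (fun j => j < i) x else 0 else 0) = 0 := by
      rw [← ite_and, if_neg (by simpa using h')]
    rw [e1, e2, star_zero]

/-- Changing the occupation of the smaller mode flips the sign string of the larger one, and not
conversely; the two orders therefore differ by exactly one sign. -/
lemma ladderOp_mul_ladderOp {i j : Λ} (hij : i ≠ j) (b b' : Bool) :
    ladderOp i b * ladderOp j b' = -(ladderOp j b' * ladderOp i b) := by
  rw [ladderOp, ladderOp, monomialMatrix_mul, monomialMatrix_mul]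
  ext x y
  simp only [monomialMatrix, Matrix.neg_apply, Function.comp_apply,
    Function.update_comm hij b b' y, Function.update_of_ne hij, Function.update_of_ne hij.symm]
  by_cases hx : x = Function.update (Function.update y j b') i b
  swap
  · simp [hx]
  rw [if_pos hx, if_pos hx]
  by_cases hi : y i = !b
  swap
  · simp [hi]
  by_cases hj : y j = !b'
  swap
  · simp [hj]
  simp only [hi, hj, if_true]
  rcases lt_or_gt_of_ne hij with h | h
  · rw [occSign_update_of_not (fun k => k < i) y (lt_asymm h),
      occSign_update (fun k => k < j) y h hi]
    ring
  · rw [occSign_update_of_not (fun k => k < j) y (lt_asymm h),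
      occSign_update (fun k => k < i) y h hj]
    ring

lemma parityOp_mul_parityOp : (parityOp : Op Λ) * parityOp = 1 := by
  rw [parityOp_eq_monomialMatrix, monomialMatrix_mul]
  ext x y
  simp [monomialMatrix, Matrix.one_apply, occSign_mul_self]

lemma parityOp_mul_ladderOp_mul_parityOp (i : Λ) (b : Bool) :
    parityOp * ladderOp i b * parityOp = -ladderOp i b := by
  rw [parityOp_eq_monomialMatrix, ladderOp, monomialMatrix_mul, monomialMatrix_mul]
  ext x y
  simp only [monomialMatrix, Function.comp_apply, id, Matrix.neg_apply]
  by_cases hi : y i = !b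
  swap
  · simp [hi]
  split_ifs
  · rw [occSign_update _ y trivial hi]
    linear_combination (-occSign (fun j => j < i) y) * occSign_mul_self (fun _ => True) y
  · simp

/-- Each generator of B anticommutes with the outside ladder operator and changes sign under parity
conjugation. Both sides respect sums and products in B, so the identity passes from generators to
the whole algebra. -/
lemma ladderOp_mul_of_mem_adjoin {I : Finset Λ} {B : Op Λ}
    (hB : IsSupportedOn SystemKind.fermion I B) {j : Λ} (hj : j ∉ I) (b : Bool) :
    ladderOp j b * B = parityOp * B * parityOp * ladderOp j b := by
  have hgen : ∀ i ∈ I, ∀ b', ladderOp j b * ladderOp i b' =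
      parityOp * ladderOp i b' * parityOp * ladderOp j b := by
    intro i hi b'
    rw [parityOp_mul_ladderOp_mul_parityOp, ladderOp_mul_ladderOp (by rintro rfl; exact hj hi)]
    simp
  induction hB using Algebra.adjoin_induction with
  | mem x hx =>
    rcases hx with ⟨i, hi, rfl⟩ | ⟨i, hi, rfl⟩
    · rw [annihilation_eq_ladderOp]; exact hgen i hi _
    · rw [conjTranspose_annihilation_eq_ladderOp]; exact hgen i hi _
  | algebraMap r =>
    rw [Algebra.algebraMap_eq_smul_one]
    simp [parityOp_mul_parityOp]
  | add x y _ _ hx hy => simp only [mul_add, add_mul, hx, hy]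
  | mul x y _ _ hx hy =>
    calc ladderOp j b * (x * y) = parityOp * x * parityOp * (ladderOp j b * y) := by
          rw [← mul_assoc, hx]; simp only [mul_assoc]
      _ = parityOp * x * (parityOp * parityOp) * y * parityOp * ladderOp j b := by
          rw [hy]; simp only [mul_assoc]
      _ = _ := by rw [parityOp_mul_parityOp]; simp only [mul_assoc, one_mul]

end Fermion

/-! ### Operators with given support form a star-closed algebra. -/

section Support

variable {Λ : Type} [Fintype Λ] [LinearOrder Λ]

/-- The algebra of operators supported on `I`. -/
def supportAlgebra (k : SystemKind) (I : Finset Λ) : Subalgebra ℂ (Op Λ) :=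
  match k with
  | SystemKind.qubit =>
    { carrier := {A | ∃ B, A = qubitEmbed I B}
      mul_mem' := by
        rintro _ _ ⟨B, rfl⟩ ⟨C, rfl⟩
        exact ⟨B * C, qubitEmbed_mul I B C⟩
      add_mem' := by
        rintro _ _ ⟨B, rfl⟩ ⟨C, rfl⟩
        exact ⟨B + C, by ext; simp [qubitEmbed, add_mul]⟩
      algebraMap_mem' := fun r => ⟨r • 1, by
        rw [Algebra.algebraMap_eq_smul_one, ← qubitEmbed_one I]
        rw [qubitEmbed, qubitEmbed, Matrix.smul_kronecker, Matrix.submatrix_smul]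
        rfl⟩ }
  | SystemKind.fermion => Algebra.adjoin ℂ
      ({B : Op Λ | ∃ i ∈ I, B = annihilation i} ∪ {B : Op Λ | ∃ i ∈ I, B = (annihilation i)ᴴ})

lemma mem_supportAlgebra {k : SystemKind} {I : Finset Λ} {A : Op Λ} :
    A ∈ supportAlgebra k I ↔ IsSupportedOn k I A := by
  cases k with
  | qubit => exact (isSupportedOn_qubit_iff I A).symm
  | fermion => exact Iff.rfl

lemma conjTranspose_mem_supportAlgebra {k : SystemKind} {I : Finset Λ} {A : Op Λ}
    (hA : A ∈ supportAlgebra k I) : Aᴴ ∈ supportAlgebra k I := by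
  cases k with
  | qubit =>
    obtain ⟨B, rfl⟩ := hA
    exact ⟨Bᴴ, by simp [qubitEmbed, Matrix.conjTranspose_kronecker]⟩
  | fermion =>
    change A ∈ Algebra.adjoin ℂ _ at hA
    change Aᴴ ∈ Algebra.adjoin ℂ _
    induction hA using Algebra.adjoin_induction with
    | mem x hx =>
      apply Algebra.subset_adjoin
      rcases hx with ⟨i, hi, rfl⟩ | ⟨i, hi, rfl⟩
      · exact Or.inr ⟨i, hi, rfl⟩
      · exact Or.inl ⟨i, hi, by simp⟩
    | algebraMap r =>
      rw [Algebra.algebraMap_eq_smul_one, Matrix.conjTranspose_smul, Matrix.conjTranspose_one]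
      exact Subalgebra.smul_mem _ (Subalgebra.one_mem _) _
    | add x y _ _ hx hy => rw [Matrix.conjTranspose_add]; exact Subalgebra.add_mem _ hx hy
    | mul x y _ _ hx hy => rw [Matrix.conjTranspose_mul]; exact Subalgebra.mul_mem _ hy hx

lemma supportAlgebra_mono {k : SystemKind} {I J : Finset Λ} (hIJ : I ⊆ J) :
    supportAlgebra k I ≤ supportAlgebra k J := by
  cases k with
  | qubit =>
    rintro _ ⟨B, rfl⟩
    exact exists_qubitEmbed_of_subset hIJ B
  | fermion =>
    refine Algebra.adjoin_mono ?_
    rintro x (⟨i, hi, rfl⟩ | ⟨i, hi, rfl⟩)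
    · exact Or.inl ⟨i, hIJ hi, rfl⟩
    · exact Or.inr ⟨i, hIJ hi, rfl⟩

/-- Operators with disjoint supports commute if one of them is physical. -/
lemma commute_of_disjoint {k : SystemKind} {I J : Finset Λ} (hIJ : Disjoint I J) {B A : Op Λ}
    (hB : IsSupportedOn k I B) (hB' : IsPhysical k B) (hA : IsSupportedOn k J A) :
    Commute B A := by
  cases k with
  | qubit =>
    obtain ⟨B, rfl⟩ := (isSupportedOn_qubit_iff I B).1 hB
    obtain ⟨A, rfl⟩ := (isSupportedOn_qubit_iff J A).1 hA
    obtain ⟨C, hC⟩ := exists_qubitEmbedCompl_of_disjoint hIJ A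
    rw [hC]
    exact commute_qubitEmbed_compl I B C
  | fermion =>
    -- Evenness of B removes the parity conjugation, so B commutes with every generator on J; A
    -- itself may be odd.
    have hgen : ∀ j ∈ J, ∀ b, B * ladderOp j b = ladderOp j b * B := by
      intro j hj b
      rw [ladderOp_mul_of_mem_adjoin hB (fun hi => Finset.disjoint_left.1 hIJ hi hj) b]
      rw [show parityOp * B * parityOp = B from hB']
    have hle : Algebra.adjoin ℂ ({B : Op Λ | ∃ i ∈ J, B = annihilation i} ∪
        {B : Op Λ | ∃ i ∈ J, B = (annihilation i)ᴴ}) ≤ Subalgebra.centralizer ℂ {B} := by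
      refine Algebra.adjoin_le ?_
      rintro x (⟨i, hi, rfl⟩ | ⟨i, hi, rfl⟩) _ rfl
      · rw [annihilation_eq_ladderOp]; exact hgen i hi _
      · rw [conjTranspose_annihilation_eq_ladderOp]; exact hgen i hi _
    exact Subalgebra.mem_centralizer_iff ℂ |>.1 (hle hA) B rfl

end Support

/-! ### Gaussian and Lorentzian kernels and their Fourier transforms. -/

section Kernels

/-- `f` is a rapidly decaying kernel with Fourier transform `φ`. -/
structure IsFourierKernel (f φ : ℝ → ℂ) : Prop where
  continuous : Continuous f
  integrable_weight : ∀ w : ℝ, MeasureTheory.Integrable fun t => ‖f t‖ * Real.exp (w * |t|)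
  integral_eq : ∀ ν : ℝ, ∫ t : ℝ, f t * Complex.exp ((Complex.I * t) * ν) = φ ν

/-- The kernel of the filter `e^{-β² ν² / 8 + s ν}`. -/
noncomputable def gaussKernel (β s : ℝ) (t : ℝ) : ℂ :=
  (((Real.pi : ℂ) / -(-(2 / β ^ 2 : ℝ) : ℂ)) ^ (1 / 2 : ℂ))⁻¹ *
    Complex.exp ((-(2 / β ^ 2 : ℝ) : ℂ) * t ^ 2 + (-(4 * s / β ^ 2 : ℝ) * Complex.I : ℂ) * t +
      (2 * s ^ 2 / β ^ 2 : ℝ))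

lemma continuous_gaussKernel (β s : ℝ) : Continuous (gaussKernel β s) := by
  unfold gaussKernel
  fun_prop

lemma neg_two_div_sq_re {β : ℝ} (hβ : 0 < β) : (-(2 / β ^ 2 : ℝ) : ℂ).re < 0 := by
  rw [Complex.neg_re, Complex.ofReal_re, neg_lt_zero]
  positivity

/-- An exponential in t only changes the linear term of the Gaussian exponent, and e^{w|t|} ≤ e^{wt}
+ e^{-wt} reduces to that case. -/
lemma integrable_gaussKernel_weight {β : ℝ} (hβ : 0 < β) (s w : ℝ) :
    MeasureTheory.Integrable fun t => ‖gaussKernel β s t‖ * Real.exp (w * |t|) := by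
  have hint : ∀ w : ℝ, MeasureTheory.Integrable fun t =>
      ‖gaussKernel β s t‖ * Real.exp (w * t) := by
    intro w
    have h := ((integrable_cexp_quadratic' (neg_two_div_sq_re hβ)
      (-(4 * s / β ^ 2 : ℝ) * Complex.I + w : ℂ) (2 * s ^ 2 / β ^ 2 : ℝ)).const_mul
      ((((Real.pi : ℂ) / -(-(2 / β ^ 2 : ℝ) : ℂ)) ^ (1 / 2 : ℂ))⁻¹)).norm
    refine h.congr (Filter.Eventually.of_forall fun t => ?_)
    simp only [gaussKernel, norm_mul, mul_assoc]
    congr 1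
    rw [show Real.exp (w * t) = ‖Complex.exp ((w : ℂ) * t)‖ by
      rw [← Complex.ofReal_mul, Complex.norm_exp_ofReal], ← norm_mul, ← Complex.exp_add]
    congr 2
    ring
  refine ((hint w).add (hint (-w))).mono' ?_ (Filter.Eventually.of_forall fun t => ?_)
  · exact ((continuous_gaussKernel β s).norm.mul (by fun_prop)).aestronglyMeasurable
  · rw [Real.norm_of_nonneg (by positivity), Pi.add_apply, ← mul_add]
    gcongr
    rcases abs_cases t with h | h <;> rw [h.1]
    · linarith [Real.exp_pos (-w * t)]
    · rw [mul_neg, ← neg_mul]; linarith [Real.exp_pos (w * t)]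

lemma gaussKernel_mul_cexp (β s ν t : ℝ) :
    gaussKernel β s t * Complex.exp ((Complex.I * t) * ν) =
      (((Real.pi : ℂ) / -(-(2 / β ^ 2 : ℝ) : ℂ)) ^ (1 / 2 : ℂ))⁻¹ *
        Complex.exp ((-(2 / β ^ 2 : ℝ) : ℂ) * t ^ 2 +
          (-(4 * s / β ^ 2 : ℝ) * Complex.I + Complex.I * ν : ℂ) * t +
          (2 * s ^ 2 / β ^ 2 : ℝ)) := by
  rw [gaussKernel, mul_assoc, ← Complex.exp_add]
  congr 2
  ring

/-- The Gaussian symbol `e^{-β² ν² / 8 + s ν}`. -/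
noncomputable def gaussSymbol (β s : ℝ) (ν : ℝ) : ℂ :=
  Complex.exp ((-(β ^ 2 * ν ^ 2) / 8 + s * ν : ℝ) : ℂ)

/-- The kernel is a multiple of exp(-2(t + is)²/β²): the shift of the centred Gaussian into the
complex plane produces the factor e^{sν}. The prefactor is the inverse of the constant in the
Gaussian integral, so the two cancel. -/
lemma isFourierKernel_gaussKernel {β : ℝ} (hβ : 0 < β) (s : ℝ) :
    IsFourierKernel (gaussKernel β s) (gaussSymbol β s) where
  continuous := continuous_gaussKernel β s
  integrable_weight := integrable_gaussKernel_weight hβ s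
  integral_eq ν := by
    have hC : ((Real.pi : ℂ) / -(-(2 / β ^ 2 : ℝ) : ℂ)) ^ (1 / 2 : ℂ) ≠ 0 := by
      rw [Complex.cpow_ne_zero_iff]
      left
      have : (β : ℂ) ≠ 0 := by exact_mod_cast hβ.ne'
      have := Real.pi_pos.ne'
      simp [*]
    simp only [gaussKernel_mul_cexp]
    rw [MeasureTheory.integral_const_mul, integral_cexp_quadratic (neg_two_div_sq_re hβ),
      ← mul_assoc, inv_mul_cancel₀ hC, one_mul, gaussSymbol]
    congr 1
    have : (β : ℂ) ≠ 0 := by exact_mod_cast hβ.ne'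
    push_cast
    field_simp
    ring_nf
    simp only [Complex.I_sq]
    ring

/-- The kernel of the derivative of the Gaussian filter. -/
noncomputable def gaussDerivKernel (β s : ℝ) (t : ℝ) : ℂ :=
  (Complex.I * (2 * (-(2 / β ^ 2 : ℝ) : ℂ) * t + (-(4 * s / β ^ 2 : ℝ) * Complex.I : ℂ))) *
    gaussKernel β s t

/-- The kernel is i times the derivative of the Gaussian kernel, and integration by parts turns the
derivative into multiplication by ν. -/
lemma isFourierKernel_gaussDerivKernel {β : ℝ} (hβ : 0 < β) (s : ℝ) :
    IsFourierKernel (gaussDerivKernel β s) (fun ν => ν * gaussSymbol β s ν) := by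
  have hcont : Continuous (gaussDerivKernel β s) := by
    have := continuous_gaussKernel β s
    unfold gaussDerivKernel
    fun_prop
  have hint : ∀ w : ℝ, MeasureTheory.Integrable
      fun t => ‖gaussDerivKernel β s t‖ * Real.exp (w * |t|) := by
    intro w
    -- The linear prefactor is dominated by a multiple of e^{|t|}, hence the weight w + 1.
    refine ((integrable_gaussKernel_weight hβ s (w + 1)).const_mul
      (4 / β ^ 2 + ‖(-(4 * s / β ^ 2 : ℝ) * Complex.I : ℂ)‖)).mono'
      (hcont.norm.mul (by fun_prop)).aestronglyMeasurable (Filter.Eventually.of_forall fun t => ?_)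
    rw [Real.norm_of_nonneg (by positivity), gaussDerivKernel, norm_mul, norm_mul, Complex.norm_I,
      one_mul, show (w + 1) * |t| = w * |t| + |t| by ring, Real.exp_add]
    have h1 : |t| ≤ Real.exp |t| := (by linarith : |t| ≤ |t| + 1).trans (Real.add_one_le_exp _)
    have h2 : 1 ≤ Real.exp |t| := Real.one_le_exp (abs_nonneg t)
    have h3 : ‖(2 * (-(2 / β ^ 2 : ℝ) : ℂ) * t + (-(4 * s / β ^ 2 : ℝ) * Complex.I : ℂ))‖ ≤
        (4 / β ^ 2 + ‖(-(4 * s / β ^ 2 : ℝ) * Complex.I : ℂ)‖) * Real.exp |t| := by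
      refine (norm_add_le _ _).trans ?_
      rw [add_mul]
      refine add_le_add ?_ (le_mul_of_one_le_right (norm_nonneg _) h2)
      rw [norm_mul, norm_mul, norm_neg, Complex.norm_real, Complex.norm_real, Complex.norm_two,
        Real.norm_of_nonneg (by positivity), Real.norm_eq_abs, ← mul_div_assoc,
        show (2 : ℝ) * 2 = 4 by norm_num]
      gcongr
    calc _ ≤ ((4 / β ^ 2 + ‖(-(4 * s / β ^ 2 : ℝ) * Complex.I : ℂ)‖) * Real.exp |t|) *
          ‖gaussKernel β s t‖ * Real.exp (w * |t|) := by gcongr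
      _ = _ := by ring
  refine ⟨hcont, hint, fun ν => ?_⟩
  set F : ℝ → ℂ := fun t => gaussKernel β s t * Complex.exp ((Complex.I * t) * ν) with hF
  have hnorm : ∀ t : ℝ, ‖Complex.exp ((Complex.I * t) * ν)‖ = 1 := fun t => by
    rw [show (Complex.I * t) * ν = ((t * ν : ℝ) : ℂ) * Complex.I by push_cast; ring,
      Complex.norm_exp_ofReal_mul_I]
  have hcexp : Continuous fun t : ℝ => Complex.exp ((Complex.I * t) * ν) := by fun_prop
  have hFint : MeasureTheory.Integrable F := by
    refine (integrable_gaussKernel_weight hβ s 0).mono'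
      ((continuous_gaussKernel β s).mul hcexp).aestronglyMeasurable
      (Filter.Eventually.of_forall fun t => ?_)
    simp [hF, hnorm]
  have hGint : MeasureTheory.Integrable
      fun t : ℝ => gaussDerivKernel β s t * Complex.exp ((Complex.I * t) * ν) := by
    refine (hint 0).mono' (hcont.mul hcexp).aestronglyMeasurable
      (Filter.Eventually.of_forall fun t => ?_)
    simp [hnorm]
  have hder : ∀ t, HasDerivAt F (-Complex.I *
      (gaussDerivKernel β s t * Complex.exp ((Complex.I * t) * ν)) + Complex.I * ν * F t) t := by
    intro t
    have hF' : F = fun t : ℝ => (((Real.pi : ℂ) / -(-(2 / β ^ 2 : ℝ) : ℂ)) ^ (1 / 2 : ℂ))⁻¹ *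
        Complex.exp ((-(2 / β ^ 2 : ℝ) : ℂ) * t ^ 2 +
          (-(4 * s / β ^ 2 : ℝ) * Complex.I + Complex.I * ν : ℂ) * t +
          (2 * s ^ 2 / β ^ 2 : ℝ)) := funext fun t => gaussKernel_mul_cexp β s ν t
    have hid : HasDerivAt (fun t : ℝ => (t : ℂ)) 1 t := Complex.ofRealCLM.hasDerivAt
    have h1 := (((((hid.pow 2).const_mul (-(2 / β ^ 2 : ℝ) : ℂ)).add
      (hid.const_mul (-(4 * s / β ^ 2 : ℝ) * Complex.I + Complex.I * ν : ℂ))).add_const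
      ((2 * s ^ 2 / β ^ 2 : ℝ) : ℂ)).cexp).const_mul
      ((((Real.pi : ℂ) / -(-(2 / β ^ 2 : ℝ) : ℂ)) ^ (1 / 2 : ℂ))⁻¹)
    have h2 : -Complex.I * (gaussDerivKernel β s t * Complex.exp ((Complex.I * t) * ν)) +
        Complex.I * ν * F t = (2 * (-(2 / β ^ 2 : ℝ) : ℂ) * t +
          (-(4 * s / β ^ 2 : ℝ) * Complex.I + Complex.I * ν : ℂ)) * F t := by
      simp only [hF, gaussDerivKernel]
      linear_combination (-((2 * (-(2 / β ^ 2 : ℝ) : ℂ) * t +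
        (-(4 * s / β ^ 2 : ℝ) * Complex.I : ℂ))) * gaussKernel β s t *
        Complex.exp ((Complex.I * t) * ν)) * Complex.I_sq
    rw [h2, hF']
    convert! h1 using 1
    simp only [Pi.add_apply, Pi.pow_apply]
    push_cast
    ring
  -- The integral of the total derivative of f(t) e^{itν} vanishes; this is the integration by parts
  -- without boundary terms.
  have h0 := MeasureTheory.integral_eq_zero_of_hasDerivAt_of_integrable hder
    ((hGint.const_mul _).add (hFint.const_mul _)) hFint
  rw [MeasureTheory.integral_add (hGint.const_mul _) (hFint.const_mul _),
    MeasureTheory.integral_const_mul, MeasureTheory.integral_const_mul,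
    (isFourierKernel_gaussKernel hβ s).integral_eq] at h0
  linear_combination Complex.I * h0 + ((∫ t : ℝ, gaussDerivKernel β s t *
    Complex.exp ((Complex.I * t) * ν)) - ν * gaussSymbol β s ν) * Complex.I_sq

/-- The kernel of the Lorentzian `1 / (ν² + b²)`. -/
noncomputable def lorentzKernel (b t : ℝ) : ℂ := ((1 / (2 * b) * Real.exp (-b * |t|) : ℝ) : ℂ)

lemma integrableOn_Iic_cexp {b : ℝ} {z : ℂ} (hz : |z.re| < b) : MeasureTheory.IntegrableOn
    (fun t : ℝ => Complex.exp (-b * |t| : ℝ) * Complex.exp (z * t)) (Set.Iic 0) := by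
  refine (integrableOn_exp_mul_complex_Iic (a := b + z) ?_ 0).congr_fun ?_ measurableSet_Iic
  · simp only [Complex.add_re, Complex.ofReal_re]; linarith [(abs_lt.1 hz).1]
  · intro t ht
    simp only
    rw [← Complex.exp_add, abs_of_nonpos ht]
    push_cast
    ring_nf

lemma integrableOn_Ioi_cexp {b : ℝ} {z : ℂ} (hz : |z.re| < b) : MeasureTheory.IntegrableOn
    (fun t : ℝ => Complex.exp (-b * |t| : ℝ) * Complex.exp (z * t)) (Set.Ioi 0) := by
  refine (integrableOn_exp_mul_complex_Ioi (a := -b + z) ?_ 0).congr_fun ?_ measurableSet_Ioi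
  · simp only [Complex.add_re, Complex.neg_re, Complex.ofReal_re]; linarith [(abs_lt.1 hz).2]
  · intro t ht
    simp only
    rw [← Complex.exp_add, abs_of_pos ht]
    push_cast
    ring_nf

lemma integrable_cexp_neg_mul_abs {b : ℝ} {z : ℂ} (hz : |z.re| < b) : MeasureTheory.Integrable
    (fun t : ℝ => Complex.exp (-b * |t| : ℝ) * Complex.exp (z * t)) := by
  rw [← MeasureTheory.integrableOn_univ, ← Set.Iic_union_Ioi (a := (0 : ℝ))]
  exact (integrableOn_Iic_cexp hz).union (integrableOn_Ioi_cexp hz)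

lemma integral_cexp_neg_mul_abs {b : ℝ} {z : ℂ} (hz : |z.re| < b) :
    ∫ t : ℝ, Complex.exp (-b * |t| : ℝ) * Complex.exp (z * t) = 1 / (b + z) + 1 / (b - z) := by
  rw [← intervalIntegral.integral_Iic_add_Ioi (integrableOn_Iic_cexp hz) (integrableOn_Ioi_cexp hz)]
  congr 1
  · rw [MeasureTheory.setIntegral_congr_fun measurableSet_Iic
      (g := fun t : ℝ => Complex.exp ((b + z) * t)), integral_exp_mul_complex_Iic]
    · simp
    · simp only [Complex.add_re, Complex.ofReal_re]; linarith [(abs_lt.1 hz).1]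
    · intro t ht
      simp only
      rw [← Complex.exp_add, abs_of_nonpos ht]
      push_cast
      ring_nf
  · rw [MeasureTheory.setIntegral_congr_fun measurableSet_Ioi
      (g := fun t : ℝ => Complex.exp ((-b + z) * t)), integral_exp_mul_complex_Ioi]
    · simp only [Complex.ofReal_zero, mul_zero, Complex.exp_zero]
      rw [neg_div, ← div_neg]
      ring_nf
    · simp only [Complex.add_re, Complex.neg_re, Complex.ofReal_re]; linarith [(abs_lt.1 hz).2]
    · intro t ht
      simp only
      rw [← Complex.exp_add, abs_of_pos ht]
      push_cast
      ring_nf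

lemma integrable_exp_neg_mul_abs {a : ℝ} (ha : 0 < a) :
    MeasureTheory.Integrable fun t : ℝ => Real.exp (-a * |t|) := by
  have := (integrable_cexp_neg_mul_abs (b := a) (z := 0) (by simpa using ha)).norm
  refine this.congr (Filter.Eventually.of_forall fun t => ?_)
  simp only [zero_mul, Complex.exp_zero, mul_one, Complex.norm_exp_ofReal]

lemma integral_exp_neg_mul_abs {a : ℝ} (ha : 0 < a) :
    ∫ t : ℝ, Real.exp (-a * |t|) = 2 / a := by
  have := integral_cexp_neg_mul_abs (b := a) (z := 0) (by simpa using ha)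
  simp only [zero_mul, Complex.exp_zero, mul_one, ← Complex.ofReal_exp] at this
  rw [integral_complex_ofReal] at this
  apply Complex.ofReal_injective
  rw [this]
  push_cast
  ring

lemma norm_lorentzKernel_mul {b : ℝ} (hb : 0 < b) (w t : ℝ) :
    ‖lorentzKernel b t‖ * Real.exp (w * |t|) = 1 / (2 * b) * Real.exp (-(b - w) * |t|) := by
  rw [lorentzKernel, Complex.norm_real, Real.norm_of_nonneg (by positivity), mul_assoc,
    ← Real.exp_add]
  ring_nf

lemma continuous_lorentzKernel (b : ℝ) : Continuous (lorentzKernel b) := by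
  unfold lorentzKernel
  fun_prop

lemma integrable_lorentzKernel_weight {b w : ℝ} (hb : 0 < b) (hw : w < b) :
    MeasureTheory.Integrable fun t => ‖lorentzKernel b t‖ * Real.exp (w * |t|) := by
  simp only [norm_lorentzKernel_mul hb]
  exact (integrable_exp_neg_mul_abs (sub_pos.2 hw)).const_mul _

/-- Unlike the Gaussian kernels, this one tolerates only growth rates below b, which is what limits
the rate allowed in the dynamics. -/
lemma integral_lorentzKernel_weight {b w : ℝ} (hb : 0 < b) (hw : w < b) :
    ∫ t, ‖lorentzKernel b t‖ * Real.exp (w * |t|) = 1 / (b * (b - w)) := by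
  simp only [norm_lorentzKernel_mul hb]
  rw [MeasureTheory.integral_const_mul, integral_exp_neg_mul_abs (sub_pos.2 hw)]
  have := (sub_pos.2 hw).ne'
  field_simp

lemma integral_lorentzKernel_mul_cexp {b : ℝ} (hb : 0 < b) (ν : ℝ) :
    ∫ t : ℝ, lorentzKernel b t * Complex.exp ((Complex.I * t) * ν) =
      ((1 / (ν ^ 2 + b ^ 2) : ℝ) : ℂ) := by
  have hz : |(Complex.I * ν).re| < b := by simpa using hb
  have h1 : ∀ t : ℝ, lorentzKernel b t * Complex.exp ((Complex.I * t) * ν) =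
      (1 / (2 * b) : ℝ) * (Complex.exp (-b * |t| : ℝ) * Complex.exp (Complex.I * ν * t)) := by
    intro t
    rw [lorentzKernel]
    push_cast
    ring_nf
  simp only [h1]
  rw [MeasureTheory.integral_const_mul, integral_cexp_neg_mul_abs hz]
  have h2 : (b : ℂ) + Complex.I * ν ≠ 0 := fun h => by
    have := congrArg Complex.re h
    simp at this
    exact hb.ne' this
  have h3 : (b : ℂ) - Complex.I * ν ≠ 0 := fun h => by
    have := congrArg Complex.re h
    simp at this
    exact hb.ne' this
  have h4 : (ν : ℂ) ^ 2 + b ^ 2 ≠ 0 := by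
    have : ν ^ 2 + b ^ 2 ≠ 0 := by positivity
    exact_mod_cast this
  have h5 : (b : ℂ) ≠ 0 := by exact_mod_cast hb.ne'
  push_cast
  field_simp
  ring_nf
  simp only [Complex.I_sq]
  ring

end Kernels

/-! ### Partial fraction expansion of the hyperbolic tangent. -/

section Tanh

/-- This is the Mittag-Leffler series of the cotangent on the imaginary axis, where its terms become
real Lorentzians. -/
lemma hasSum_cot_imaginary {y : ℝ} (hy : y ≠ 0) :
    HasSum (fun n : ℕ => ((2 * y / (y ^ 2 + (n + 1) ^ 2) : ℝ) : ℂ))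
      (Complex.I * (Real.pi * Complex.cot (Real.pi * (Complex.I * y)) - 1 / (Complex.I * y))) := by
  have hz : Complex.I * (y : ℂ) ∈ Complex.integerComplement := by
    rintro ⟨n, hn⟩
    have := congrArg Complex.im hn
    simp at this
    exact hy this.symm
  have h := (summable_cotTerm hz).hasSum
  rw [show ∑' n, cotTerm (Complex.I * (y : ℂ)) n = _ from (cot_series_rep' hz).symm] at h
  refine (h.mul_left Complex.I).congr_fun ?_
  intro n
  rw [cotTerm_identity hz n]
  have h1 : (Complex.I * y + (n + 1)) * (Complex.I * y - (n + 1)) =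
      -((y : ℂ) ^ 2 + (n + 1) ^ 2) := by
    linear_combination (y : ℂ) ^ 2 * Complex.I_sq
  have h2 : (y : ℂ) ^ 2 + (n + 1) ^ 2 ≠ 0 := by
    have : y ^ 2 + ((n : ℝ) + 1) ^ 2 ≠ 0 := by positivity
    exact_mod_cast this
  rw [h1]
  push_cast
  field_simp
  linear_combination (y : ℂ) * Complex.I_sq

lemma two_mul_cot_two_mul_sub_cot {z : ℂ} (hs : Complex.sin z ≠ 0) (hc : Complex.cos z ≠ 0) :
    2 * Complex.cot (2 * z) - Complex.cot z = -Complex.tan z := by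
  rw [Complex.cot, Complex.cot, Complex.tan, Complex.sin_two_mul, Complex.cos_two_mul]
  field_simp
  linear_combination Complex.sin_sq_add_cos_sq z

/-- The cotangent series at 2y runs over all positive integers and the one at y over the even ones.
Their difference leaves the odd integers, and the identity 2 cot 2z - cot z = -tan z evaluates it.
-/
lemma hasSum_tanh (y : ℝ) :
    HasSum (fun k : ℕ => 8 * y / (4 * y ^ 2 + (2 * k + 1) ^ 2)) (Real.pi * Real.tanh (Real.pi * y)) := by
  rcases eq_or_ne y 0 with rfl | hy
  · simp
  set f : ℕ → ℂ := fun n => ((8 * y / (4 * y ^ 2 + (n + 1) ^ 2) : ℝ) : ℂ) with hf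
  have hall := (hasSum_cot_imaginary (y := 2 * y) (by simpa using hy)).mul_left 2
  have hodd := hasSum_cot_imaginary hy
  have e1 : (fun n : ℕ => 2 * ((2 * (2 * y) / ((2 * y) ^ 2 + (n + 1) ^ 2) : ℝ) : ℂ)) = f := by
    funext n
    simp only [hf]
    push_cast
    ring
  have e2 : (fun n : ℕ => ((2 * y / (y ^ 2 + (n + 1) ^ 2) : ℝ) : ℂ)) = fun k => f (2 * k + 1) := by
    funext n
    simp only [hf]
    congr 1
    have h2 : y ^ 2 + ((n : ℝ) + 1) ^ 2 ≠ 0 := by positivity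
    have h3 : 4 * y ^ 2 + (((2 * n + 1 : ℕ) : ℝ) + 1) ^ 2 ≠ 0 := by positivity
    rw [div_eq_div_iff h2 h3]
    push_cast
    ring
  rw [e1] at hall
  rw [e2] at hodd
  have heven : Summable fun k => f (2 * k) :=
    hall.summable.comp_injective (mul_right_injective₀ two_ne_zero)
  have hsum := (heven.hasSum.even_add_odd hodd).unique hall
  have hval : ∑' k, f (2 * k) = ((Real.pi * Real.tanh (Real.pi * y) : ℝ) : ℂ) := by
    have hs : Complex.sin (Real.pi * (Complex.I * y)) ≠ 0 := by
      rw [show (Real.pi : ℂ) * (Complex.I * y) = ((Real.pi * y : ℝ) : ℂ) * Complex.I by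
        push_cast; ring, Complex.sin_mul_I]
      refine mul_ne_zero ?_ Complex.I_ne_zero
      rw [← Complex.ofReal_sinh, Complex.ofReal_ne_zero, Ne, Real.sinh_eq_zero]
      exact mul_ne_zero Real.pi_pos.ne' hy
    have hc : Complex.cos (Real.pi * (Complex.I * y)) ≠ 0 := by
      rw [show (Real.pi : ℂ) * (Complex.I * y) = ((Real.pi * y : ℝ) : ℂ) * Complex.I by
        push_cast; ring, Complex.cos_mul_I, ← Complex.ofReal_cosh, Complex.ofReal_ne_zero]
      exact (Real.cosh_pos _).ne'
    have hcot := two_mul_cot_two_mul_sub_cot hs hc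
    have htan : Complex.tan (Real.pi * (Complex.I * y)) =
        Complex.I * ((Real.tanh (Real.pi * y) : ℝ) : ℂ) := by
      rw [show (Real.pi : ℂ) * (Complex.I * y) = ((Real.pi * y : ℝ) : ℂ) * Complex.I by
        push_cast; ring, Complex.tan_mul_I, Complex.ofReal_tanh, mul_comm]
    rw [htan] at hcot
    have harg : (Real.pi : ℂ) * (Complex.I * ((2 * y : ℝ) : ℂ)) =
        2 * (Real.pi * (Complex.I * y)) := by push_cast; ring
    rw [harg] at hsum
    have hy' : (y : ℂ) ≠ 0 := by exact_mod_cast hy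
    have hinv : 2 * (1 / (Complex.I * ((2 * y : ℝ) : ℂ))) = 1 / (Complex.I * (y : ℂ)) := by
      push_cast
      have := Complex.I_ne_zero
      field_simp
    rw [Complex.ofReal_mul]
    linear_combination hsum + Complex.I * Real.pi * hcot - Complex.I * hinv -
      (Real.pi : ℂ) * ((Real.tanh (Real.pi * y) : ℝ) : ℂ) * Complex.I_sq
  have h : HasSum (fun k : ℕ => ((8 * y / (4 * y ^ 2 + (((2 * k : ℕ) : ℝ) + 1) ^ 2) : ℝ) : ℂ))
      ((Real.pi * Real.tanh (Real.pi * y) : ℝ) : ℂ) := hval ▸ heven.hasSum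
  simpa using Complex.hasSum_ofReal.1 h

/-- The poles of `ν ↦ tanh (β ν / 4)` are `± i b_k`. -/
noncomputable def tanhPole (β : ℝ) (k : ℕ) : ℝ := 2 * Real.pi * (2 * k + 1) / β

lemma hasSum_tanh_mul {β : ℝ} (hβ : 0 < β) (ν : ℝ) :
    HasSum (fun k : ℕ => 8 / β * (ν / (ν ^ 2 + tanhPole β k ^ 2))) (Real.tanh (β * ν / 4)) := by
  have h := (hasSum_tanh (β * ν / (4 * Real.pi))).mul_left Real.pi⁻¹
  have hpi := Real.pi_pos.ne'
  have e : Real.pi⁻¹ * (Real.pi * Real.tanh (Real.pi * (β * ν / (4 * Real.pi)))) =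
      Real.tanh (β * ν / 4) := by
    rw [inv_mul_cancel_left₀ hpi]
    congr 1
    field_simp
  rw [e] at h
  refine h.congr_fun fun k => ?_
  have hb : 0 < tanhPole β k := by
    have := Real.pi_pos
    unfold tanhPole
    positivity
  have h1 : ν ^ 2 + tanhPole β k ^ 2 ≠ 0 := by positivity
  have h2 : 4 * (β * ν / (4 * Real.pi)) ^ 2 + (2 * k + 1) ^ 2 =
      (β / (2 * Real.pi)) ^ 2 * (ν ^ 2 + tanhPole β k ^ 2) := by
    unfold tanhPole
    field_simp
    ring
  rw [h2]
  field_simp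
  ring

lemma tanhPole_pos {β : ℝ} (hβ : 0 < β) (k : ℕ) : 0 < tanhPole β k := by
  have := Real.pi_pos
  unfold tanhPole
  positivity

lemma summable_inv_tanhPole_sq (β : ℝ) : Summable fun k => 1 / tanhPole β k ^ 2 := by
  have h : Summable fun k : ℕ => 1 / (k : ℝ) ^ 2 := Real.summable_one_div_nat_pow.2 one_lt_two
  have h2 := (h.comp_injective (i := fun k : ℕ => 2 * k + 1) fun a b hab => by
    simpa using hab).mul_left ((β / (2 * Real.pi)) ^ 2)
  refine h2.congr fun k => ?_
  simp only [tanhPole, Function.comp_apply]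
  push_cast
  field_simp

end Tanh

/-! ### Stability of closeness under products and filters. -/

section Close

variable {Λ : Type} [Fintype Λ] [LinearOrder Λ]

lemma norm_cexp_I_mul_mul (t ν : ℝ) : ‖Complex.exp ((Complex.I * t) * ν)‖ = 1 := by
  rw [show (Complex.I * t) * ν = ((t * ν : ℝ) : ℂ) * Complex.I by push_cast; ring,
    Complex.norm_exp_ofReal_mul_I]

/-- The Fourier representation is applied to each pair of energies. Plain integrability is assumed
instead of `IsFourierKernel` because the Lorentzian kernels are not integrable against every
exponential weight. -/
lemma bohrFilter_eq_integral {f φ : ℝ → ℂ} (hf : MeasureTheory.Integrable f)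
    (hφ : ∀ ν : ℝ, ∫ t : ℝ, f t * Complex.exp ((Complex.I * t) * ν) = φ ν) (H X : Op Λ) :
    bohrFilter φ H X = ∫ t, f t • evol H t X := by
  have hint : ∀ ν : ℝ, MeasureTheory.Integrable
      fun t : ℝ => f t * Complex.exp ((Complex.I * t) * ν) := by
    intro ν
    refine hf.mul_bdd (c := 1) (by fun_prop) (Filter.Eventually.of_forall fun t => ?_)
    exact (norm_cexp_I_mul_mul t ν).le
  simp only [evol, bohrFilter_eq_sum, Finset.smul_sum, smul_smul]
  rw [MeasureTheory.integral_finsetSum]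
  · refine Finset.sum_congr rfl fun E _ => ?_
    rw [MeasureTheory.integral_finsetSum]
    · refine Finset.sum_congr rfl fun E' _ => ?_
      rw [integral_smul_const, hφ]
    · exact fun E' _ => (hint _).smul_const _
  · exact fun E _ => MeasureTheory.integrable_finsetSum _ fun E' _ => (hint _).smul_const _

lemma integrable_smul_evol {f : ℝ → ℂ} (hf : MeasureTheory.Integrable f) {H : Op Λ}
    (hH : H.IsHermitian) (X : Op Λ) : MeasureTheory.Integrable fun t => f t • evol H t X :=
  hf.smul_bdd ‖X‖ (continuous_evol hH X).aestronglyMeasurable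
    (Filter.Eventually.of_forall fun t => (norm_evol hH t X).le)

/-- `X` and `X'` are bounded and have close evolutions under `H` and `H'`. -/
structure IsClose (H H' X X' : Op Λ) (b δ w : ℝ) : Prop where
  norm_left : ‖X‖ ≤ b
  norm_right : ‖X'‖ ≤ b
  norm_sub : ∀ t, ‖evol H t X - evol H' t X'‖ ≤ δ * Real.exp (w * |t|)

lemma IsClose.norm_sub_zero {H H' X X' : Op Λ} {b δ w : ℝ} (h : IsClose H H' X X' b δ w)
    (hH : H.IsHermitian) (hH' : H'.IsHermitian) : ‖X - X'‖ ≤ δ := by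
  simpa [evol_zero hH, evol_zero hH'] using h.norm_sub 0

/-- Heisenberg evolution is multiplicative and isometric, so a telescoping step gives a product rule
for the errors with the same rate w. -/
lemma IsClose.mul {H H' X X' Y Y' : Op Λ} {b₁ b₂ δ₁ δ₂ w : ℝ} (hX : IsClose H H' X X' b₁ δ₁ w)
    (hY : IsClose H H' Y Y' b₂ δ₂ w) (hH : H.IsHermitian) (hH' : H'.IsHermitian) :
    IsClose H H' (X * Y) (X' * Y') (b₁ * b₂) (δ₁ * b₂ + b₁ * δ₂) w := by
  have hb₁ : 0 ≤ b₁ := (norm_nonneg _).trans hX.norm_left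
  refine ⟨?_, ?_, fun t => ?_⟩
  · exact (norm_mul_le _ _).trans (mul_le_mul hX.norm_left hY.norm_left (norm_nonneg _) hb₁)
  · exact (norm_mul_le _ _).trans (mul_le_mul hX.norm_right hY.norm_right (norm_nonneg _) hb₁)
  · rw [evol_mul hH, evol_mul hH',
      show evol H t X * evol H t Y - evol H' t X' * evol H' t Y' =
        (evol H t X - evol H' t X') * evol H t Y + evol H' t X' * (evol H t Y - evol H' t Y') by
          noncomm_ring]
    have h0 : 0 ≤ δ₁ * Real.exp (w * |t|) := (norm_nonneg _).trans (hX.norm_sub t)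
    refine (norm_add_le _ _).trans ?_
    calc _ ≤ ‖evol H t X - evol H' t X'‖ * ‖evol H t Y‖ +
          ‖evol H' t X'‖ * ‖evol H t Y - evol H' t Y'‖ :=
          add_le_add (norm_mul_le _ _) (norm_mul_le _ _)
      _ ≤ (δ₁ * Real.exp (w * |t|)) * b₂ + b₁ * (δ₂ * Real.exp (w * |t|)) := by
          rw [norm_evol hH, norm_evol hH']
          gcongr
          · exact hX.norm_sub t
          · exact hY.norm_left
          · exact hX.norm_right
          · exact hY.norm_sub t
      _ = _ := by ring

lemma IsClose.add {H H' X X' Y Y' : Op Λ} {b₁ b₂ δ₁ δ₂ w : ℝ} (hX : IsClose H H' X X' b₁ δ₁ w)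
    (hY : IsClose H H' Y Y' b₂ δ₂ w) :
    IsClose H H' (X + Y) (X' + Y') (b₁ + b₂) (δ₁ + δ₂) w := by
  refine ⟨(norm_add_le _ _).trans (add_le_add hX.norm_left hY.norm_left),
    (norm_add_le _ _).trans (add_le_add hX.norm_right hY.norm_right), fun t => ?_⟩
  rw [evol, evol, bohrFilter_add_op, bohrFilter_add_op, add_sub_add_comm, add_mul]
  exact (norm_add_le _ _).trans (add_le_add (hX.norm_sub t) (hY.norm_sub t))

lemma evol_bohrFilter (φ : ℝ → ℂ) (H X : Op Λ) (t : ℝ) :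
    evol H t (bohrFilter φ H X) = bohrFilter φ H (evol H t X) := by
  rw [evol, evol, ← bohrFilter_mul_symbol, ← bohrFilter_mul_symbol]
  simp_rw [mul_comm]

lemma norm_bohrFilter_le {f φ : ℝ → ℂ} (hf : MeasureTheory.Integrable f)
    (hφ : ∀ ν : ℝ, ∫ t : ℝ, f t * Complex.exp ((Complex.I * t) * ν) = φ ν) {H X : Op Λ}
    (hH : H.IsHermitian) : ‖bohrFilter φ H X‖ ≤ (∫ t, ‖f t‖) * ‖X‖ := by
  rw [bohrFilter_eq_integral hf hφ, ← MeasureTheory.integral_mul_const]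
  refine (MeasureTheory.norm_integral_le_integral_norm _).trans (le_of_eq ?_)
  simp only [norm_smul, norm_evol hH]

lemma norm_bohrFilter_sub_le {f φ : ℝ → ℂ} (hf : MeasureTheory.Integrable f) {w : ℝ}
    (hfw : MeasureTheory.Integrable fun t => ‖f t‖ * Real.exp (w * |t|))
    (hφ : ∀ ν : ℝ, ∫ t : ℝ, f t * Complex.exp ((Complex.I * t) * ν) = φ ν) {H H' X X' : Op Λ}
    (hH : H.IsHermitian) (hH' : H'.IsHermitian) {δ : ℝ}
    (h : ∀ t, ‖evol H t X - evol H' t X'‖ ≤ δ * Real.exp (w * |t|)) :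
    ‖bohrFilter φ H X - bohrFilter φ H' X'‖ ≤ (∫ t, ‖f t‖ * Real.exp (w * |t|)) * δ := by
  rw [bohrFilter_eq_integral hf hφ, bohrFilter_eq_integral hf hφ,
    ← MeasureTheory.integral_sub (integrable_smul_evol hf hH X) (integrable_smul_evol hf hH' X'),
    ← MeasureTheory.integral_mul_const]
  refine MeasureTheory.norm_integral_le_of_norm_le (hfw.mul_const δ)
    (Filter.Eventually.of_forall fun t => ?_)
  rw [← smul_sub, norm_smul, mul_assoc, mul_comm _ δ]
  gcongr
  exact h t

/-- Evolution commutes with the filter, and e^{w|s+t|} ≤ e^{w|s|} e^{w|t|} puts one factor into the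
weighted norm of the kernel and leaves the other as the same growth in t. -/
lemma IsClose.bohrFilter {f φ : ℝ → ℂ} (hf : IsFourierKernel f φ) {H H' X X' : Op Λ} {b δ w : ℝ}
    (hX : IsClose H H' X X' b δ w) (hH : H.IsHermitian) (hH' : H'.IsHermitian) (hw : 0 ≤ w) :
    IsClose H H' (bohrFilter φ H X) (bohrFilter φ H' X') ((∫ t, ‖f t‖) * b)
      ((∫ t, ‖f t‖ * Real.exp (w * |t|)) * δ) w := by
  have hint : MeasureTheory.Integrable f := by
    refine (MeasureTheory.integrable_norm_iff hf.continuous.aestronglyMeasurable).1 ?_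
    simpa using hf.integrable_weight 0
  have h0 : 0 ≤ ∫ t, ‖f t‖ := MeasureTheory.integral_nonneg fun t => norm_nonneg _
  have hδ : 0 ≤ δ := by simpa using (norm_nonneg _).trans (hX.norm_sub 0)
  refine ⟨(norm_bohrFilter_le hint hf.integral_eq hH).trans
    (mul_le_mul_of_nonneg_left hX.norm_left h0),
    (norm_bohrFilter_le hint hf.integral_eq hH').trans
    (mul_le_mul_of_nonneg_left hX.norm_right h0), fun t => ?_⟩
  rw [evol_bohrFilter, evol_bohrFilter, mul_assoc]
  refine norm_bohrFilter_sub_le hint (hf.integrable_weight w) hf.integral_eq hH hH' fun s => ?_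
  rw [evol_add, evol_add]
  refine (hX.norm_sub (s + t)).trans ?_
  rw [mul_assoc, ← Real.exp_add, ← mul_add]
  gcongr
  rw [add_comm]
  exact abs_add_le t s

lemma hasSum_bohrFilter {φ : ℕ → ℝ → ℂ} {ψ : ℝ → ℂ} (h : ∀ ν, HasSum (fun k => φ k ν) (ψ ν))
    (H X : Op Λ) : HasSum (fun k => bohrFilter (φ k) H X) (bohrFilter ψ H X) := by
  simp only [bohrFilter_eq_sum]
  exact hasSum_sum fun E _ => hasSum_sum fun E' _ => (h _).smul_const _

lemma integrable_lorentzKernel {b : ℝ} (hb : 0 < b) :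
    MeasureTheory.Integrable (lorentzKernel b) := by
  refine (MeasureTheory.integrable_norm_iff (continuous_lorentzKernel b).aestronglyMeasurable).1 ?_
  simpa using integrable_lorentzKernel_weight (w := 0) hb hb

/-- The hyperbolic tangent filter preserves closeness if the commutators with the Hamiltonians
are close. -/
lemma norm_bohrFilter_tanh_sub_le {β : ℝ} (hβ : 0 < β) {H H' M M' : Op Λ} (hH : H.IsHermitian)
    (hH' : H'.IsHermitian) {b δ w : ℝ} (hw : w * β ≤ Real.pi)
    (hN : IsClose H H' (bohrFilter (fun ν => (ν : ℂ)) H M) (bohrFilter (fun ν => (ν : ℂ)) H' M')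
      b δ w) :
    ‖bohrFilter (fun ν => Complex.I / 2 * (Real.tanh (β * ν / 4) : ℂ)) H M -
      bohrFilter (fun ν => Complex.I / 2 * (Real.tanh (β * ν / 4) : ℂ)) H' M'‖ ≤
      (8 / β * ∑' k, 1 / tanhPole β k ^ 2) * δ := by
  have hδ : 0 ≤ δ := by simpa using (norm_nonneg _).trans (hN.norm_sub 0)
  -- The factor ν stands to the right of the Lorentzian so that it acts on M and becomes the
  -- commutator controlled by `hN`.
  set φ : ℕ → ℝ → ℂ := fun k ν =>
    (Complex.I / 2 * (8 / β : ℝ)) * (((1 / (ν ^ 2 + tanhPole β k ^ 2) : ℝ) : ℂ) * ν) with hφ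
  have hsum : ∀ ν : ℝ, HasSum (fun k => φ k ν) (Complex.I / 2 * (Real.tanh (β * ν / 4) : ℂ)) := by
    intro ν
    refine ((Complex.hasSum_ofReal.2 (hasSum_tanh_mul hβ ν)).mul_left (Complex.I / 2)).congr_fun
      fun k => ?_
    simp only [hφ]
    push_cast
    ring
  have hconst : ∀ (c : ℂ) (ψ : ℝ → ℂ) (H X : Op Λ),
      bohrFilter (fun ν => c * ψ ν) H X = c • bohrFilter ψ H X := fun c ψ H X => by
    simp only [bohrFilter_eq_sum, Finset.smul_sum, smul_smul]
  have hterm : ∀ k, ‖bohrFilter (φ k) H M - bohrFilter (φ k) H' M'‖ ≤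
      8 / β * (1 / tanhPole β k ^ 2) * δ := by
    intro k
    have hb := tanhPole_pos hβ k
    -- All poles satisfy b_k ≥ 2π/β ≥ 2w, so b_k(b_k - w) ≥ b_k²/2 and the errors are summable in k.
    have hwb : w ≤ tanhPole β k / 2 := by
      rw [tanhPole, le_div_iff₀ two_pos, le_div_iff₀ hβ]
      have : (0 : ℝ) ≤ k := Nat.cast_nonneg k
      nlinarith [Real.pi_pos, mul_nonneg Real.pi_pos.le this]
    have hwb' : w < tanhPole β k := by linarith
    simp only [hφ]
    rw [hconst, hconst, bohrFilter_mul_symbol, bohrFilter_mul_symbol, ← smul_sub, norm_smul]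
    have h1 := norm_bohrFilter_sub_le (integrable_lorentzKernel hb)
      (integrable_lorentzKernel_weight hb hwb') (integral_lorentzKernel_mul_cexp hb) hH hH'
      hN.norm_sub
    rw [integral_lorentzKernel_weight hb hwb'] at h1
    have h2 : ‖Complex.I / 2 * ((8 / β : ℝ) : ℂ)‖ = 1 / 2 * (8 / β) := by
      rw [norm_mul, norm_div, Complex.norm_I, Complex.norm_two, Complex.norm_real,
        Real.norm_of_nonneg (by positivity)]
    rw [h2]
    have h3 : 1 / (tanhPole β k * (tanhPole β k - w)) ≤ 2 * (1 / tanhPole β k ^ 2) := by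
      rw [mul_one_div, div_le_div_iff₀ (mul_pos hb (sub_pos.2 hwb')) (by positivity)]
      nlinarith
    calc _ ≤ 1 / 2 * (8 / β) * (2 * (1 / tanhPole β k ^ 2) * δ) := by
          gcongr
          exact h1.trans (by gcongr)
      _ = _ := by ring
  have hs := (hasSum_bohrFilter hsum H M).sub (hasSum_bohrFilter hsum H' M')
  exact hs.norm_le_of_bounded
    (((summable_inv_tanhPole_sq β).hasSum.mul_left (8 / β)).mul_right δ) hterm

end Close

/-! ### The local ingredients as Gaussian filters. -/

section Symbols

variable {Λ : Type} [Fintype Λ] [LinearOrder Λ]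

lemma lindbladOp_eq (β : ℝ) (H A : Op Λ) :
    lindbladOp β H A = bohrFilter (gaussSymbol β (-(β / 4))) H A := by
  rw [lindbladOp]
  congr 1
  ext ν
  rw [gaussianFilter, gaussSymbol, Complex.ofReal_exp]
  congr 2
  ring

lemma cexp_mul_gaussSymbol (β s u ν : ℝ) :
    Complex.exp ((u : ℝ) * ν) * gaussSymbol β s ν = gaussSymbol β (s + u) ν := by
  rw [gaussSymbol, gaussSymbol, ← Complex.exp_add]
  congr 1
  push_cast
  ring

/-- L has s = -β/4 and the conjugation adds β/4. -/
lemma tildeL_eq {H : Op Λ} (hH : H.IsHermitian) (β : ℝ) (A : Op Λ) :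
    tildeL β H A = bohrFilter (gaussSymbol β 0) H A := by
  rw [tildeL, neg_div, gibbsPow_mul_mul_gibbsPow hH, lindbladOp_eq, ← bohrFilter_mul_symbol]
  congr 1
  ext ν
  rw [cexp_mul_gaussSymbol]
  congr 1
  ring

lemma conjTranspose_lindbladOp (β : ℝ) {H A : Op Λ} (hA : A.IsHermitian) :
    (lindbladOp β H A)ᴴ = bohrFilter (gaussSymbol β (β / 4)) H A := by
  rw [lindbladOp_eq, conjTranspose_bohrFilter, hA.eq]
  congr 1
  ext ν
  simp only [gaussSymbol, ← Complex.ofReal_exp, RCLike.star_def, Complex.conj_ofReal]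
  congr 2
  ring

/-- `σ^{-1/4} L† L σ^{1/4}`. -/
noncomputable def tildeLL (β : ℝ) (H A : Op Λ) : Op Λ :=
  bohrFilter (gaussSymbol β (β / 2)) H A * bohrFilter (gaussSymbol β 0) H A

/-- Conjugation is multiplicative: it takes L†, with s = β/4, to s = β/2, and L to s = 0. -/
lemma tildeLL_eq {H A : Op Λ} (hH : H.IsHermitian) (hA : A.IsHermitian) (β : ℝ) :
    gibbsPow β H (-(1 / 4)) * ((lindbladOp β H A)ᴴ * lindbladOp β H A) * gibbsPow β H (1 / 4) =
      tildeLL β H A := by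
  rw [gibbsPow_mul_mul_gibbsPow hH, bohrFilter_cexp_mul hH, conjTranspose_lindbladOp β hA,
    ← bohrFilter_mul_symbol, ← gibbsPow_mul_mul_gibbsPow hH, tildeLL, ← tildeL_eq hH, tildeL,
    neg_div]
  congr 2
  ext ν
  rw [cexp_mul_gaussSymbol]
  congr 1
  ring

lemma coherentTerm_unit (β : ℝ) (H A : Op Λ) :
    coherentTerm β H (fun _ : Unit => A) =
      bohrFilter (fun ν => Complex.I / 2 * (Real.tanh (β * ν / 4) : ℂ)) H
        ((lindbladOp β H A)ᴴ * lindbladOp β H A) := by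
  simp [coherentTerm]

/-- The conjugation is itself a filter and commutes with the tanh filter, so it can be carried out
on L†L. -/
lemma tildeG_eq {H A : Op Λ} (hH : H.IsHermitian) (hA : A.IsHermitian) (β : ℝ) :
    tildeG β H A = bohrFilter (fun ν => Complex.I / 2 * (Real.tanh (β * ν / 4) : ℂ)) H
      (tildeLL β H A) := by
  rw [tildeG, neg_div, gibbsPow_mul_mul_gibbsPow hH, coherentTerm_unit, ← bohrFilter_mul_symbol,
    ← tildeLL_eq hH hA, gibbsPow_mul_mul_gibbsPow hH, ← bohrFilter_mul_symbol]
  simp_rw [mul_comm]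

/-- The adjoint conjugates the symbol and reverses ν; i tanh(βν/4) is unchanged because tanh is odd.
-/
lemma coherentTerm_isHermitian (β : ℝ) (H A : Op Λ) :
    (coherentTerm β H (fun _ : Unit => A)).IsHermitian := by
  rw [coherentTerm_unit, Matrix.IsHermitian, conjTranspose_bohrFilter, Matrix.conjTranspose_mul,
    Matrix.conjTranspose_conjTranspose]
  congr 1
  ext ν
  rw [show β * -ν / 4 = -(β * ν / 4) by ring, Real.tanh_neg]
  simp only [star_mul', RCLike.star_def, map_neg, Complex.conj_ofReal, map_div₀, Complex.conj_I, map_ofNat,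
    Complex.ofReal_neg]
  ring

/-- The Leibniz rule puts the factor ν on one Gaussian symbol at a time, where the derivative kernel
handles it. -/
lemma bohrFilter_ofReal_tildeLL {H : Op Λ} (hH : H.IsHermitian) (β : ℝ) (A : Op Λ) :
    bohrFilter (fun ν => (ν : ℂ)) H (tildeLL β H A) =
      bohrFilter (fun ν => ν * gaussSymbol β (β / 2) ν) H A * bohrFilter (gaussSymbol β 0) H A +
      bohrFilter (gaussSymbol β (β / 2)) H A * bohrFilter (fun ν => ν * gaussSymbol β 0 ν) H A := by
  rw [tildeLL, bohrFilter_ofReal_mul hH, bohrFilter_mul_symbol (fun ν => (ν : ℂ)),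
    bohrFilter_mul_symbol (fun ν => (ν : ℂ))]

/-- All the local ingredients of the parent Hamiltonian depend continuously on the evolution of the
jump operator. -/
lemma exists_norm_sub_le {β : ℝ} (hβ : 0 < β) {w : ℝ} (hw : 0 ≤ w) (hwβ : w * β ≤ Real.pi) :
    ∃ c : ℝ, 0 ≤ c ∧ ∀ (Λ : Type) [Fintype Λ] [LinearOrder Λ] (H H' A : Op Λ) (δ : ℝ),
      H.IsHermitian → H'.IsHermitian → A.IsHermitian → IsClose H H' A A 1 δ w →
      ‖lindbladOp β H A - lindbladOp β H' A‖ ≤ c * δ ∧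
      ‖tildeL β H A - tildeL β H' A‖ ≤ c * δ ∧
      ‖tildeG β H A - tildeG β H' A‖ ≤ c * δ ∧
      ‖tildeLL β H A - tildeLL β H' A‖ ≤ c * δ ∧
      ‖tildeL β H A‖ ≤ c ∧ ‖tildeL β H' A‖ ≤ c := by
  have hk := isFourierKernel_gaussKernel hβ
  have hd := isFourierKernel_gaussDerivKernel hβ
  set n : (ℝ → ℂ) → ℝ := fun f => ∫ t, ‖f t‖ with hn
  set m : (ℝ → ℂ) → ℝ := fun f => ∫ t, ‖f t‖ * Real.exp (w * |t|) with hm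
  have hn0 : ∀ f, 0 ≤ n f := fun f => MeasureTheory.integral_nonneg fun t => norm_nonneg _
  have hm0 : ∀ f, 0 ≤ m f := fun f => MeasureTheory.integral_nonneg fun t => by positivity
  set τ : ℝ := 8 / β * ∑' k, 1 / tanhPole β k ^ 2 with hτ
  have hτ0 : 0 ≤ τ := mul_nonneg (by positivity) (tsum_nonneg fun k => by positivity)
  set f₀ := gaussKernel β 0
  set f₁ := gaussKernel β (β / 2)
  set g₀ := gaussDerivKernel β 0
  set g₁ := gaussDerivKernel β (β / 2)
  set f₂ := gaussKernel β (-(β / 4))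
  -- `c₁` is the product-rule error of M̃. `c₂` is that of its commutator with H, multiplied by the
  -- cost τ of the tanh filter. All norms involve the kernels only, so c is fixed before the
  -- lattice.
  set c₁ := m f₁ * n f₀ + n f₁ * m f₀ with hc₁
  set c₂ := τ * (m g₁ * n f₀ + n g₁ * m f₀ + (m f₁ * n g₀ + n f₁ * m g₀)) with hc₂
  have p : ∀ f g, 0 ≤ m f * n g := fun f g => mul_nonneg (hm0 f) (hn0 g)
  have p' : ∀ f g, 0 ≤ n f * m g := fun f g => mul_nonneg (hn0 f) (hm0 g)
  have hc₁0 : 0 ≤ c₁ := add_nonneg (p _ _) (p' _ _)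
  have hc₂0 : 0 ≤ c₂ := mul_nonneg hτ0
    (add_nonneg (add_nonneg (p _ _) (p' _ _)) (add_nonneg (p _ _) (p' _ _)))
  have hf₂ := hm0 f₂
  have hf₀ := hm0 f₀
  have hf₀' := hn0 f₀
  refine ⟨m f₂ + m f₀ + n f₀ + c₁ + c₂, by positivity,
    fun Λ _ _ H H' A δ hH hH' hA hcl => ?_⟩
  have hδ : 0 ≤ δ := (norm_nonneg _).trans (hcl.norm_sub_zero hH hH')
  have hL := hcl.bohrFilter (hk (-(β / 4))) hH hH' hw
  have hQ := hcl.bohrFilter (hk 0) hH hH' hw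
  have hP := hcl.bohrFilter (hk (β / 2)) hH hH' hw
  have hQ' := hcl.bohrFilter (hd 0) hH hH' hw
  have hP' := hcl.bohrFilter (hd (β / 2)) hH hH' hw
  have hM := hP.mul hQ hH hH'
  have hN := (hP'.mul hQ hH hH').add (hP.mul hQ' hH hH')
  rw [← bohrFilter_ofReal_tildeLL hH, ← bohrFilter_ofReal_tildeLL hH'] at hN
  have hG := norm_bohrFilter_tanh_sub_le hβ hH hH' hwβ hN
  refine ⟨?_, ?_, ?_, ?_, ?_, ?_⟩
  · rw [lindbladOp_eq, lindbladOp_eq]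
    refine (hL.norm_sub_zero hH hH').trans (mul_le_mul_of_nonneg_right ?_ hδ)
    change m f₂ ≤ _
    linarith
  · rw [tildeL_eq hH, tildeL_eq hH']
    refine (hQ.norm_sub_zero hH hH').trans (mul_le_mul_of_nonneg_right ?_ hδ)
    change m f₀ ≤ _
    linarith
  · rw [tildeG_eq hH hA, tildeG_eq hH' hA]
    refine hG.trans (le_trans (le_of_eq ?_)
      (mul_le_mul_of_nonneg_right (by linarith : c₂ ≤ _) hδ))
    change τ * (m g₁ * δ * (n f₀ * 1) + n g₁ * 1 * (m f₀ * δ) +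
      (m f₁ * δ * (n g₀ * 1) + n f₁ * 1 * (m g₀ * δ))) = _
    rw [hc₂]
    ring
  · refine (hM.norm_sub_zero hH hH').trans (le_trans (le_of_eq ?_)
      (mul_le_mul_of_nonneg_right (by linarith : c₁ ≤ _) hδ))
    change m f₁ * δ * (n f₀ * 1) + n f₁ * 1 * (m f₀ * δ) = _
    rw [hc₁]
    ring
  · rw [tildeL_eq hH]
    refine hQ.norm_left.trans ?_
    change n f₀ * 1 ≤ _
    linarith
  · rw [tildeL_eq hH']
    refine hQ.norm_right.trans ?_
    change n f₀ * 1 ≤ _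
    linarith

end Symbols

/-! ### Norms of vectorised superoperators. -/

section SuperNorm

/-- The adjoint of the transpose is the entrywise conjugate of Y, and complex conjugation of vectors
is isometric. -/
lemma l2_opNorm_transpose_le {n : Type} [Fintype n] [DecidableEq n] (Y : Matrix n n ℂ) :
    ‖Yᵀ‖ ≤ ‖Y‖ := by
  have hstar : ∀ v : n → ℂ, ‖WithLp.toLp 2 (star v)‖ = ‖WithLp.toLp 2 v‖ := fun v => by
    simp [EuclideanSpace.norm_eq]
  rw [← Matrix.l2_opNorm_conjTranspose, Matrix.l2_opNorm_def]
  refine ContinuousLinearMap.opNorm_le_bound _ (norm_nonneg _) fun x => ?_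
  have h1 : (Yᵀ)ᴴ *ᵥ x.ofLp = star (Y *ᵥ star x.ofLp) := by
    ext i
    simp [Matrix.mulVec, dotProduct, Matrix.conjTranspose_apply]
  have h2 := Matrix.l2_opNorm_mulVec Y (WithLp.toLp 2 (star x.ofLp))
  rw [hstar] at h2
  refine le_trans (le_of_eq ?_) h2
  change ‖WithLp.toLp 2 ((Yᵀ)ᴴ *ᵥ x.ofLp)‖ = _
  rw [h1, hstar]
  rfl

variable {Λ : Type} [Fintype Λ] [LinearOrder Λ]

open scoped Kronecker

lemma stdBasis_repr_apply (X : Op Λ) (i j : Λ → Bool) :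
    (Matrix.stdBasis ℂ (Λ → Bool) (Λ → Bool)).repr X (i, j) = X i j := by
  simp [Matrix.stdBasis]

lemma toMatrix_mulLeft (X : Op Λ) :
    LinearMap.toMatrix (Matrix.stdBasis ℂ (Λ → Bool) (Λ → Bool))
      (Matrix.stdBasis ℂ (Λ → Bool) (Λ → Bool)) (LinearMap.mulLeft ℂ X) = X ⊗ₖ 1 := by
  ext ⟨i, i'⟩ ⟨j, j'⟩
  rw [LinearMap.toMatrix_apply, Matrix.stdBasis_eq_single, LinearMap.mulLeft_apply,
    stdBasis_repr_apply, Matrix.kronecker_apply, Matrix.mul_apply, Matrix.one_apply]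
  simp [Matrix.single_apply, ite_and, eq_comm]

lemma toMatrix_mulRight (Y : Op Λ) :
    LinearMap.toMatrix (Matrix.stdBasis ℂ (Λ → Bool) (Λ → Bool))
      (Matrix.stdBasis ℂ (Λ → Bool) (Λ → Bool)) (LinearMap.mulRight ℂ Y) = 1 ⊗ₖ Yᵀ := by
  ext ⟨i, i'⟩ ⟨j, j'⟩
  rw [LinearMap.toMatrix_apply, Matrix.stdBasis_eq_single, LinearMap.mulRight_apply,
    stdBasis_repr_apply, Matrix.kronecker_apply, Matrix.mul_apply, Matrix.one_apply]
  simp [Matrix.single_apply, ite_and, eq_comm]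

/-- The star homomorphism `X ↦ X ⊗ 1`. -/
noncomputable def kroneckerOneHom (n : Type) [Fintype n] [DecidableEq n] :
    Matrix n n ℂ →⋆ₙₐ[ℂ] Matrix (n × n) (n × n) ℂ where
  toFun X := X ⊗ₖ 1
  map_smul' c X := by simp [Matrix.smul_kronecker]
  map_zero' := by simp
  map_add' X Y := by simp [Matrix.add_kronecker]
  map_mul' X Y := by rw [← Matrix.mul_kronecker_mul, one_mul]
  map_star' X := by simp [Matrix.star_eq_conjTranspose, Matrix.conjTranspose_kronecker]

/-- The star homomorphism `X ↦ 1 ⊗ X`. -/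
noncomputable def oneKroneckerHom (n : Type) [Fintype n] [DecidableEq n] :
    Matrix n n ℂ →⋆ₙₐ[ℂ] Matrix (n × n) (n × n) ℂ where
  toFun X := 1 ⊗ₖ X
  map_smul' c X := by simp [Matrix.kronecker_smul]
  map_zero' := by simp
  map_add' X Y := by simp [Matrix.kronecker_add]
  map_mul' X Y := by rw [← Matrix.mul_kronecker_mul, one_mul]
  map_star' X := by simp [Matrix.star_eq_conjTranspose, Matrix.conjTranspose_kronecker]

/-- The superoperator `ρ ↦ X ρ Y`. -/
noncomputable def sandwich (X Y : Op Λ) : SuperOp Λ :=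
  LinearMap.mulLeft ℂ X ∘ₗ LinearMap.mulRight ℂ Y

lemma superNorm_sandwich_le (X Y : Op Λ) : superNorm (sandwich X Y) ≤ ‖X‖ * ‖Y‖ := by
  rw [superNorm, sandwich, LinearMap.toMatrix_comp _ (Matrix.stdBasis ℂ (Λ → Bool) (Λ → Bool)) _,
    toMatrix_mulLeft, toMatrix_mulRight]
  refine (norm_mul_le _ _).trans (mul_le_mul
    (NonUnitalStarAlgHom.norm_apply_le (kroneckerOneHom (Λ → Bool)) X)
    ((NonUnitalStarAlgHom.norm_apply_le (oneKroneckerHom (Λ → Bool)) Yᵀ).trans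
      (l2_opNorm_transpose_le Y)) (norm_nonneg _) (norm_nonneg _))

lemma superNorm_add_le (S T : SuperOp Λ) : superNorm (S + T) ≤ superNorm S + superNorm T := by
  rw [superNorm, map_add]
  exact norm_add_le _ _

lemma superNorm_sandwich_sub_le (X X' Y Y' : Op Λ) :
    superNorm (sandwich X Y - sandwich X' Y') ≤ ‖X - X'‖ * ‖Y‖ + ‖X'‖ * ‖Y - Y'‖ := by
  have : sandwich X Y - sandwich X' Y' = sandwich (X - X') Y + sandwich X' (Y - Y') := by
    ext1 ρ
    simp only [sandwich, LinearMap.sub_apply, LinearMap.add_apply, LinearMap.comp_apply,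
      LinearMap.mulLeft_apply, LinearMap.mulRight_apply]
    noncomm_ring
  rw [this]
  exact (superNorm_add_le _ _).trans
    (add_le_add (superNorm_sandwich_le _ _) (superNorm_sandwich_le _ _))

end SuperNorm

/-! ### The parent Hamiltonian in terms of L̃, G̃ and M̃. -/

section ParentTerm

variable {Λ : Type} [Fintype Λ] [LinearOrder Λ]

/-- The non-Hermitian drift `-i G̃ - M / 2` of the parent Hamiltonian. -/
noncomputable def driftOp (β : ℝ) (H A : Op Λ) : Op Λ :=
  -Complex.I • tildeG β H A - (1 / 2 : ℂ) • tildeLL β H A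

/-- With p = σ^{1/4} and q = σ^{-1/4}, a term XρY becomes (qXp)ρ(pYq). The left factors are the
tilde operators and the right ones their adjoints, by hermiticity of G, p and q; a factor 1 stays 1
since pq = qp = 1. -/
lemma parentTerm_eq {H A : Op Λ} (hH : H.IsHermitian) (hA : A.IsHermitian) (β : ℝ) :
    parentTerm β H A = sandwich (tildeL β H A) (tildeL β H A)ᴴ + sandwich (driftOp β H A) 1 +
      sandwich 1 (driftOp β H A)ᴴ := by
  have hpq : gibbsPow β H (1 / 4) * gibbsPow β H (-(1 / 4)) = 1 := by
    simpa using gibbsPow_mul_gibbsPow_neg hH β (-(1 / 4))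
  have hqp := gibbsPow_mul_gibbsPow_neg hH β (1 / 4)
  have hG := (coherentTerm_isHermitian β H A).eq
  have hp := conjTranspose_gibbsPow H β (1 / 4)
  have hq := conjTranspose_gibbsPow H β (-(1 / 4))
  rw [driftOp, ← tildeLL_eq hH hA, tildeL, tildeG, neg_div]
  rw [parentTerm, parentHamiltonian, lindbladianDagger, gammaPow, gammaPow,
    show (-1 / 2 / 2 : ℝ) = -(1 / 4) by norm_num, show (1 / 2 / 2 : ℝ) = 1 / 4 by norm_num]
  simp only [Finset.univ_unique, Finset.sum_singleton]
  set p := gibbsPow β H (1 / 4)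
  set q := gibbsPow β H (-(1 / 4))
  set G := coherentTerm β H fun _ : Unit => A
  set L := lindbladOp β H A
  have hqp' : ∀ X, q * (p * X) = X := fun X => by rw [← mul_assoc, hqp, one_mul]
  ext1 ρ
  simp only [sandwich, LinearMap.sub_apply, LinearMap.add_apply, LinearMap.comp_apply,
    LinearMap.smul_apply, LinearMap.neg_apply, LinearMap.mulLeft_apply, LinearMap.mulRight_apply, mul_neg,
    Matrix.conjTranspose_sub, Matrix.conjTranspose_smul, Matrix.conjTranspose_mul,
    Matrix.conjTranspose_conjTranspose, hG, hp, hq, mul_assoc, mul_add, add_mul, mul_sub, sub_mul,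
    smul_mul_assoc, mul_smul_comm, hpq, hqp', mul_one, one_mul, smul_sub, smul_add,
    neg_smul, neg_mul, Matrix.conjTranspose_neg, RCLike.star_def, Complex.conj_I, map_div₀, map_one,
    map_ofNat]
  module

/-- The dissipator is a sum over jumps, and the coherent term is linear in Σ_a L_a†L_a, so no cross
terms between jumps arise. -/
lemma parentHamiltonian_eq_sum {α : Type} [Fintype α] (β : ℝ) (H : Op Λ) (A : α → Op Λ) :
    parentHamiltonian β H A = ∑ a, parentTerm β H (A a) := by
  have h : lindbladianDagger β H A = ∑ a, lindbladianDagger β H (fun _ : Unit => A a) := by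
    have hG : coherentTerm β H A = ∑ a, coherentTerm β H (fun _ : Unit => A a) := by
      simp only [coherentTerm, Finset.univ_unique, Finset.sum_singleton, bohrFilter_sum_op]
    ext1 ρ
    simp only [lindbladianDagger, hG, Finset.univ_unique, Finset.sum_singleton,
      LinearMap.sum_apply, LinearMap.add_apply, LinearMap.smul_apply, LinearMap.sub_apply,
      LinearMap.mulLeft_apply, LinearMap.mulRight_apply, Finset.sum_mul, Finset.mul_sum,
      Finset.sum_add_distrib, Finset.smul_sum, ← Finset.sum_sub_distrib]
  simp only [parentTerm, parentHamiltonian, h]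
  ext1 ρ
  simp [LinearMap.sum_apply, map_sum]

/-- The jump term contributes 2c · cδ. Each of the two drift terms contributes 3/2 · cδ: one unit
from G̃ and one half from M̃. -/
lemma superNorm_parentTerm_sub_le {H H' A : Op Λ} (hH : H.IsHermitian) (hH' : H'.IsHermitian)
    (hA : A.IsHermitian) (β : ℝ) {c δ : ℝ}
    (hL : ‖tildeL β H A - tildeL β H' A‖ ≤ c * δ) (hG : ‖tildeG β H A - tildeG β H' A‖ ≤ c * δ)
    (hM : ‖tildeLL β H A - tildeLL β H' A‖ ≤ c * δ) (hc : ‖tildeL β H A‖ ≤ c)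
    (hc' : ‖tildeL β H' A‖ ≤ c) :
    superNorm (parentTerm β H A - parentTerm β H' A) ≤ (2 * c + 3) * (c * δ) := by
  have h1 : parentTerm β H A - parentTerm β H' A =
      (sandwich (tildeL β H A) (tildeL β H A)ᴴ - sandwich (tildeL β H' A) (tildeL β H' A)ᴴ) +
      (sandwich (driftOp β H A) 1 - sandwich (driftOp β H' A) 1) +
      (sandwich 1 (driftOp β H A)ᴴ - sandwich 1 (driftOp β H' A)ᴴ) := by
    rw [parentTerm_eq hH hA, parentTerm_eq hH' hA]
    abel
  have hd : ‖driftOp β H A - driftOp β H' A‖ ≤ 3 / 2 * (c * δ) := by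
    have : driftOp β H A - driftOp β H' A = -Complex.I • (tildeG β H A - tildeG β H' A) -
        (1 / 2 : ℂ) • (tildeLL β H A - tildeLL β H' A) := by
      simp only [driftOp, smul_sub]
      abel
    rw [this]
    refine (norm_sub_le _ _).trans ?_
    rw [norm_smul, norm_smul]
    norm_num
    linarith
  have e1 := superNorm_sandwich_sub_le (tildeL β H A) (tildeL β H' A) (tildeL β H A)ᴴ
    (tildeL β H' A)ᴴ
  have e2 := superNorm_sandwich_sub_le (driftOp β H A) (driftOp β H' A) 1 1
  have e3 := superNorm_sandwich_sub_le 1 1 (driftOp β H A)ᴴ (driftOp β H' A)ᴴ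
  have h0 : 0 ≤ c := (norm_nonneg _).trans hc
  have h0' : 0 ≤ c * δ := (norm_nonneg _).trans hL
  rw [← Matrix.conjTranspose_sub, Matrix.l2_opNorm_conjTranspose,
    Matrix.l2_opNorm_conjTranspose] at e1
  rw [← Matrix.conjTranspose_sub] at e3
  simp only [sub_self, norm_zero, mul_zero, zero_mul, add_zero, zero_add, norm_one, mul_one,
    one_mul, Matrix.l2_opNorm_conjTranspose] at e2 e3
  rw [h1]
  refine (superNorm_add_le _ _).trans (le_trans (add_le_add (superNorm_add_le _ _) le_rfl) ?_)
  have e4 : ‖tildeL β H A - tildeL β H' A‖ * ‖tildeL β H A‖ +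
      ‖tildeL β H' A‖ * ‖tildeL β H A - tildeL β H' A‖ ≤ c * δ * c + c * (c * δ) :=
    add_le_add (mul_le_mul hL hc (norm_nonneg _) h0') (mul_le_mul hc' hL (norm_nonneg _) h0)
  linarith

end ParentTerm

/-! ### Exact supports of the truncated objects. -/

section LocalSupport

variable {Λ : Type} [Fintype Λ] [LinearOrder Λ]

lemma tildeL_mem (𝔸 : Subalgebra ℂ (Op Λ)) {H A : Op Λ} (hH : H.IsHermitian) (hm : H ∈ 𝔸)
    (hA : A ∈ 𝔸) (β : ℝ) : tildeL β H A ∈ 𝔸 := by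
  rw [tildeL_eq hH]
  exact bohrFilter_mem 𝔸 hH hm hA _

lemma tildeLL_mem (𝔸 : Subalgebra ℂ (Op Λ)) {H A : Op Λ} (hH : H.IsHermitian) (hm : H ∈ 𝔸)
    (hA : A ∈ 𝔸) (β : ℝ) : tildeLL β H A ∈ 𝔸 :=
  𝔸.mul_mem (bohrFilter_mem 𝔸 hH hm hA _) (bohrFilter_mem 𝔸 hH hm hA _)

lemma tildeG_mem (𝔸 : Subalgebra ℂ (Op Λ)) {H A : Op Λ} (hH : H.IsHermitian) (hm : H ∈ 𝔸)
    (hA : A ∈ 𝔸) (hA' : A.IsHermitian) (β : ℝ) : tildeG β H A ∈ 𝔸 := by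
  rw [tildeG_eq hH hA']
  exact bohrFilter_mem 𝔸 hH hm (tildeLL_mem 𝔸 hH hm hA β) _

lemma isSuperSupportedOn_sandwich {k : SystemKind} {I : Finset Λ} {X Y : Op Λ}
    (hX : X ∈ supportAlgebra k I) (hY : Y ∈ supportAlgebra k I) :
    IsSuperSupportedOn k I (sandwich X Y) :=
  Submodule.subset_span ⟨X, Y, mem_supportAlgebra.1 hX, mem_supportAlgebra.1 hY, rfl⟩

lemma isSuperSupportedOn_parentTerm {k : SystemKind} {I : Finset Λ} {H A : Op Λ}
    (hH : H.IsHermitian) (hm : H ∈ supportAlgebra k I) (hA : A ∈ supportAlgebra k I)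
    (hA' : A.IsHermitian) (β : ℝ) : IsSuperSupportedOn k I (parentTerm β H A) := by
  have h1 := tildeL_mem _ hH hm hA β
  have h2 : driftOp β H A ∈ supportAlgebra k I :=
    Subalgebra.sub_mem _ (Subalgebra.smul_mem _ (tildeG_mem _ hH hm hA hA' β) _)
      (Subalgebra.smul_mem _ (tildeLL_mem _ hH hm hA β) _)
  rw [parentTerm_eq hH hA']
  exact Submodule.add_mem _ (Submodule.add_mem _
    (isSuperSupportedOn_sandwich h1 (conjTranspose_mem_supportAlgebra h1))
    (isSuperSupportedOn_sandwich h2 (Subalgebra.one_mem _)))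
    (isSuperSupportedOn_sandwich (Subalgebra.one_mem _) (conjTranspose_mem_supportAlgebra h2))

end LocalSupport

/-! ### Summability and weights on a lattice of finite dimension. -/

section Geometry

/-- On a lattice of finite dimension exponentials of the distance are uniformly summable. -/
lemma exists_sum_exp_neg_dist_le (D : ℕ) (κ : ℝ) {α : ℝ} (hα : 0 < α) :
    ∃ T : ℝ, 0 ≤ T ∧ ∀ (Λ : Type) [Fintype Λ] [PseudoMetricSpace Λ],
      (∀ (x : Λ) (r : ℝ), 0 ≤ r → ((nbhd {x} r).card : ℝ) ≤ κ * (1 + r) ^ D) →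
      ∀ y : Λ, ∑ x, Real.exp (-α * dist x y) ≤ T := by
  have hsum : Summable fun n : ℕ => |κ| * ((n : ℝ) + 2) ^ D * Real.exp (-α * n) := by
    have h := (((summable_nat_add_iff 2).2
      (Real.summable_pow_mul_exp_neg_nat_mul D hα)).mul_left (|κ| * Real.exp (2 * α)))
    refine h.congr fun n => ?_
    push_cast
    rw [show -α * ((n : ℝ) + 2) = -α * n + -(2 * α) by ring, Real.exp_add, Real.exp_neg (2 * α)]
    have := (Real.exp_pos (2 * α)).ne'
    field_simp
  have hnn : ∀ n : ℕ, 0 ≤ |κ| * ((n : ℝ) + 2) ^ D * Real.exp (-α * n) := fun n => by positivity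
  refine ⟨∑' n : ℕ, |κ| * ((n : ℝ) + 2) ^ D * Real.exp (-α * n), tsum_nonneg hnn,
    fun Λ _ _ hcard y => ?_⟩
  classical
  -- Sites are sorted into shells by the integer part n of the distance. Each shell lies in the ball
  -- of radius n + 1, so it has at most |κ|(n + 2)^D sites.
  calc ∑ x, Real.exp (-α * dist x y) ≤ ∑ x : Λ, Real.exp (-α * (⌊dist x y⌋₊ : ℝ)) := by
        refine Finset.sum_le_sum fun x _ => Real.exp_le_exp.2 ?_
        nlinarith [Nat.floor_le (dist_nonneg (x := x) (y := y))]
    _ = ∑ n ∈ Finset.univ.image fun x : Λ => ⌊dist x y⌋₊,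
        ∑ x ∈ Finset.univ.filter fun x : Λ => ⌊dist x y⌋₊ = n,
          Real.exp (-α * (⌊dist x y⌋₊ : ℝ)) :=
        (Finset.sum_fiberwise_of_maps_to (fun x _ => Finset.mem_image_of_mem _ (Finset.mem_univ x))
          _).symm
    _ ≤ ∑ n ∈ Finset.univ.image fun x : Λ => ⌊dist x y⌋₊,
        |κ| * ((n : ℝ) + 2) ^ D * Real.exp (-α * n) := by
        refine Finset.sum_le_sum fun n _ => ?_
        rw [Finset.sum_congr rfl (g := fun _ => Real.exp (-α * n)) fun x hx => by
          rw [(Finset.mem_filter.1 hx).2], Finset.sum_const, nsmul_eq_mul]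
        refine mul_le_mul_of_nonneg_right ?_ (Real.exp_pos _).le
        have hsub : (Finset.univ.filter fun x : Λ => ⌊dist x y⌋₊ = n) ⊆ nbhd {y} ((n : ℝ) + 1) := by
          intro x hx
          rw [nbhd, Finset.mem_filter]
          refine ⟨Finset.mem_univ _, y, Finset.mem_singleton_self y, ?_⟩
          rw [← (Finset.mem_filter.1 hx).2]
          exact (Nat.lt_floor_add_one _).le
        calc _ ≤ ((nbhd {y} ((n : ℝ) + 1)).card : ℝ) := by exact_mod_cast Finset.card_le_card hsub
          _ ≤ κ * (1 + ((n : ℝ) + 1)) ^ D := hcard y _ (by positivity)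
          _ ≤ |κ| * ((n : ℝ) + 2) ^ D := by
            rw [show 1 + ((n : ℝ) + 1) = (n : ℝ) + 2 by ring]
            gcongr
            exact le_abs_self κ
    _ ≤ _ := hsum.sum_le_tsum _ fun n _ => hnn n

lemma subset_nbhd {Λ : Type} [Fintype Λ] [PseudoMetricSpace Λ] (S : Finset Λ) {r : ℝ}
    (hr : 0 ≤ r) : S ⊆ nbhd S r := by
  intro x hx
  rw [nbhd, Finset.mem_filter]
  exact ⟨Finset.mem_univ _, x, hx, by simpa using hr⟩

/-- A weight which grows exponentially away from a set of bounded diameter. -/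
lemma exists_weight {Λ : Type} [Fintype Λ] [PseudoMetricSpace Λ] {D : ℕ} {κ : ℝ}
    (hcard : ∀ (x : Λ) (r : ℝ), 0 ≤ r → ((nbhd {x} r).card : ℝ) ≤ κ * (1 + r) ^ D)
    {α R : ℝ} (hα : 0 ≤ α) {S : Finset Λ} (hS : ∀ x ∈ S, ∀ y ∈ S, dist x y ≤ R) (r : ℝ) :
    ∃ w : Λ → ℝ, (∀ x, 0 ≤ w x) ∧ (∀ x y, w x ≤ w y * Real.exp (α * dist x y)) ∧
      (∀ x, x ∉ nbhd S r → 1 ≤ Real.exp (-α * r) * w x) ∧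
      ∑ y ∈ S, w y ≤ |κ| * (1 + |R|) ^ D * Real.exp (α * |R|) := by
  rcases S.eq_empty_or_nonempty with rfl | ⟨y₀, hy₀⟩
  -- For empty S every site lies outside the neighbourhood, and a constant weight suffices.
  · refine ⟨fun _ => Real.exp (α * r), fun x => (Real.exp_pos _).le, fun x y => ?_, fun x _ => ?_, ?_⟩
    · exact le_mul_of_one_le_right (Real.exp_pos _).le
        (Real.one_le_exp (mul_nonneg hα dist_nonneg))
    · rw [← Real.exp_add]
      simp
    · rw [Finset.sum_empty]
      positivity
  -- Distance to a single base point replaces distance to S; the bounded diameter costs only the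
  -- factor e^{α|R|} in the sum over S.
  · refine ⟨fun x => Real.exp (α * dist x y₀), fun x => (Real.exp_pos _).le, fun x y => ?_,
      fun x hx => ?_, ?_⟩
    · rw [← Real.exp_add, ← mul_add]
      refine Real.exp_le_exp.2 (mul_le_mul_of_nonneg_left ?_ hα)
      rw [add_comm]
      exact dist_triangle x y y₀
    · rw [← Real.exp_add]
      apply Real.one_le_exp
      have : r < dist x y₀ := by
        by_contra hcon
        exact hx (Finset.mem_filter.2 ⟨Finset.mem_univ _, y₀, hy₀, not_lt.1 hcon⟩)
      nlinarith
    · have hsub : S ⊆ nbhd {y₀} |R| := fun x hx => Finset.mem_filter.2 ⟨Finset.mem_univ _, y₀,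
        Finset.mem_singleton_self _, (hS x hx y₀ hy₀).trans (le_abs_self R)⟩
      have h1 : (S.card : ℝ) ≤ |κ| * (1 + |R|) ^ D := by
        calc (S.card : ℝ) ≤ ((nbhd {y₀} |R|).card : ℝ) := by
              exact_mod_cast Finset.card_le_card hsub
          _ ≤ κ * (1 + |R|) ^ D := hcard y₀ _ (abs_nonneg R)
          _ ≤ _ := by gcongr; exact le_abs_self κ
      calc ∑ y ∈ S, Real.exp (α * dist y y₀) ≤ ∑ y ∈ S, Real.exp (α * |R|) := by
            refine Finset.sum_le_sum fun y hy => Real.exp_le_exp.2 ?_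
            exact mul_le_mul_of_nonneg_left ((hS y hy y₀ hy₀).trans (le_abs_self R)) hα
        _ = (S.card : ℝ) * Real.exp (α * |R|) := by rw [Finset.sum_const, nsmul_eq_mul]
        _ ≤ _ := by gcongr

end Geometry

/-! ### Exponential locality of the dynamics and the final assembly. -/

/-- The evolutions of a local operator under the full Hamiltonian and under its truncation to a
ball are exponentially close in the radius. -/
lemma exists_norm_evol_sub_evol_le (k : SystemKind) (D : ℕ) (κ J μ R : ℝ) (hμ : 0 < μ) :
    ∃ c v : ℝ, 0 < c ∧ 0 < v ∧ ∀ (Λ : Type) [Fintype Λ] [LinearOrder Λ] [PseudoMetricSpace Λ],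
      (∀ (x : Λ) (r : ℝ), 0 ≤ r → ((nbhd {x} r).card : ℝ) ≤ κ * (1 + r) ^ D) →
      ∀ h : Finset Λ → Op Λ, (∀ I, (h I).IsHermitian) → (∀ I, IsSupportedOn k I (h I)) →
        (∀ I, IsPhysical k (h I)) →
        (∀ x y : Λ, ∑ I ∈ Finset.univ.filter (fun I : Finset Λ => x ∈ I ∧ y ∈ I), ‖h I‖
          ≤ J * Real.exp (-μ * dist x y)) →
      ∀ (S : Finset Λ) (A : Op Λ), IsSupportedOn k S A → (∀ x ∈ S, ∀ y ∈ S, dist x y ≤ R) →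
        ‖A‖ ≤ 1 → ∀ r t : ℝ,
        ‖evol (∑ I, h I) t A - evol (truncatedHam h (nbhd S r)) t A‖ ≤
          c * Real.exp (-(μ / 2) * r) * Real.exp (v * |t|) := by
  -- Half of the decay rate μ pays for the growth of the weight, the other half for summability over
  -- the lattice.
  obtain ⟨T, hT, hTb⟩ := exists_sum_exp_neg_dist_le D κ (half_pos hμ)
  have hk : 0 ≤ |J| * T := by positivity
  refine ⟨2 * (|J| * T) * (|κ| * (1 + |R|) ^ D * Real.exp (μ / 2 * |R|)) + 1,
    2 * (|J| * T) + 1, by positivity, by positivity, ?_⟩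
  intro Λ _ _ _ hcard h hherm hsupp hphys hdecay S A hA hS hA1 r t
  obtain ⟨w, hw0, hwlip, hwΩ, hwS⟩ := exists_weight hcard (half_pos hμ).le hS r
  have hwk : ∀ y, ∑ x, w x * ∑ Z ∈ Finset.univ.filter (fun Z : Finset Λ => x ∈ Z ∧ y ∈ Z), ‖h Z‖
      ≤ |J| * T * w y := by
    intro y
    calc _ ≤ ∑ x, (|J| * w y) * Real.exp (-(μ / 2) * dist x y) := by
          refine Finset.sum_le_sum fun x _ => ?_
          calc _ ≤ (w y * Real.exp (μ / 2 * dist x y)) * (|J| * Real.exp (-μ * dist x y)) := by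
                refine mul_le_mul (hwlip x y) ((hdecay x y).trans ?_)
                  (Finset.sum_nonneg fun _ _ => norm_nonneg _)
                  (mul_nonneg (hw0 y) (Real.exp_pos _).le)
                gcongr
                exact le_abs_self J
            _ = (|J| * w y) * (Real.exp (μ / 2 * dist x y) * Real.exp (-μ * dist x y)) := by ring
            _ = _ := by
                rw [← Real.exp_add]
                ring_nf
      _ = (|J| * w y) * ∑ x, Real.exp (-(μ / 2) * dist x y) := by rw [Finset.mul_sum]
      _ ≤ (|J| * w y) * T :=
          mul_le_mul_of_nonneg_left (hTb Λ hcard y) (mul_nonneg (abs_nonneg J) (hw0 y))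
      _ = _ := by ring
  have hmain := norm_evol_sub_evol_truncated_le hherm
    (fun Z Z' hd => commute_of_disjoint hd (hsupp Z) (hphys Z) (hsupp Z'))
    (fun Z hd => commute_of_disjoint hd (hsupp Z) (hphys Z) hA) hw0 hk hwk
    (Real.exp_pos _).le hwΩ t
  refine hmain.trans ?_
  have hSn : 0 ≤ ∑ y ∈ S, w y := Finset.sum_nonneg fun y _ => hw0 y
  have h1 : 2 * ‖A‖ * (|J| * T) * ∑ y ∈ S, w y ≤
      2 * (|J| * T) * (|κ| * (1 + |R|) ^ D * Real.exp (μ / 2 * |R|)) + 1 := by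
    calc _ ≤ 2 * 1 * (|J| * T) * (|κ| * (1 + |R|) ^ D * Real.exp (μ / 2 * |R|)) := by gcongr
      _ ≤ _ := by linarith
  rw [mul_comm (Real.exp (-(μ / 2) * r))]
  gcongr

/-- Interpolation between the trivial bound and a bound which grows exponentially in time. -/
lemma le_two_mul_rpow_of_le {a y θ : ℝ} (ha : a ≤ 2) (hay : a ≤ y) (hy : 0 < y) (hθ : 0 ≤ θ)
    (hθ1 : θ ≤ 1) : a ≤ 2 * y ^ θ := by
  rcases le_total 1 y with h | h
  · have := Real.one_le_rpow h hθ
    linarith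
  · have h1 := Real.rpow_le_rpow_of_exponent_ge hy h hθ1
    rw [Real.rpow_one] at h1
    have := Real.rpow_nonneg hy.le θ
    linarith

theorem mainTheorem6 (k : SystemKind) (β : ℝ) (hβ : 0 < β) (D : ℕ) (κ J μ R : ℝ) (hμ : 0 < μ) :
    ∃ C η : ℝ, 0 < C ∧ 0 < η ∧
      ∀ (Λ : Type) [Fintype Λ] [LinearOrder Λ] [PseudoMetricSpace Λ],
        (∀ (x : Λ) (r : ℝ), 0 ≤ r → ((nbhd {x} r).card : ℝ) ≤ κ * (1 + r) ^ D) →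
      ∀ h : Finset Λ → Op Λ,
        (∀ I, (h I).IsHermitian) →
        (∀ I, IsSupportedOn k I (h I)) →
        (∀ I, IsPhysical k (h I)) →
        (∀ x y : Λ, ∑ I ∈ Finset.univ.filter (fun I : Finset Λ => x ∈ I ∧ y ∈ I), ‖h I‖
          ≤ J * Real.exp (-μ * dist x y)) →
      ∀ (𝒜 : Type) [Fintype 𝒜] (S : 𝒜 → Finset Λ) (A : 𝒜 → Op Λ),
        (∀ a, (A a).IsHermitian) →
        (∀ a, IsSupportedOn k (S a) (A a)) →
        (∀ a, ∀ x ∈ S a, ∀ y ∈ S a, dist x y ≤ R) →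
        (∀ a, ‖A a‖ ≤ 1) →
        parentHamiltonian β (∑ I, h I) A = ∑ a, parentTerm β (∑ I, h I) (A a) ∧
        ∀ a,
          IsSuperQuasiLocalBy k (S a) C η (parentTerm β (∑ I, h I) (A a))
            (fun r => parentTerm β (truncatedHam h (nbhd (S a) r)) (A a)) ∧
          IsQuasiLocalBy k (S a) C η (lindbladOp β (∑ I, h I) (A a))
            (fun r => lindbladOp β (truncatedHam h (nbhd (S a) r)) (A a)) ∧
          IsQuasiLocalBy k (S a) C η (tildeL β (∑ I, h I) (A a))
            (fun r => tildeL β (truncatedHam h (nbhd (S a) r)) (A a)) ∧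
          IsQuasiLocalBy k (S a) C η (tildeG β (∑ I, h I) (A a))
            (fun r => tildeG β (truncatedHam h (nbhd (S a) r)) (A a)) := by
  obtain ⟨c₀, v, hc₀, hv, hevol⟩ := exists_norm_evol_sub_evol_le k D κ J μ R hμ
  -- θ is chosen so that the interpolated growth rate θv is at most π/β, half of the smallest pole
  -- of the tanh filter.
  set θ : ℝ := min 1 (Real.pi / (v * β)) with hθ
  have hθ0 : 0 < θ := lt_min one_pos (by have := Real.pi_pos; positivity)
  have hθ1 : θ ≤ 1 := min_le_left _ _
  have hwβ : θ * v * β ≤ Real.pi := by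
    have : θ ≤ Real.pi / (v * β) := min_le_right _ _
    rw [le_div_iff₀ (by positivity)] at this
    linarith
  obtain ⟨c, hc, hbound⟩ := exists_norm_sub_le hβ (mul_pos hθ0 hv).le hwβ
  have hc₀θ : 0 ≤ 2 * c₀ ^ θ := mul_nonneg two_pos.le (Real.rpow_nonneg hc₀.le θ)
  -- The factor 2c + 3 comes from the superoperator estimate and also covers the three operator
  -- bounds; the +1 makes the constant positive.
  refine ⟨(2 * c + 3) * (c * (2 * c₀ ^ θ)) + 1, μ / 2 * θ, by positivity, by positivity, ?_⟩
  intro Λ _ _ _ hcard h hherm hsupp hphys hdecay 𝒜 _ S A hA hAsupp hS hA1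
  refine ⟨parentHamiltonian_eq_sum β _ A, fun a => ?_⟩
  set H := ∑ I, h I with hHdef
  have hH : H.IsHermitian := isHermitian_sum _ hherm
  have hH' : ∀ r, (truncatedHam h (nbhd (S a) r)).IsHermitian := fun r => isHermitian_sum _ hherm
  have hmem : ∀ r, truncatedHam h (nbhd (S a) r) ∈ supportAlgebra k (nbhd (S a) r) := fun r =>
    Subalgebra.sum_mem _ fun I hI => supportAlgebra_mono (Finset.mem_filter.1 hI).2
      (mem_supportAlgebra.2 (hsupp I))
  have hAmem : ∀ r, 0 ≤ r → A a ∈ supportAlgebra k (nbhd (S a) r) := fun r hr =>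
    supportAlgebra_mono (subset_nbhd _ hr) (mem_supportAlgebra.2 (hAsupp a))
  -- Raising the Lieb-Robinson bound to the power θ scales the spatial rate and the temporal rate
  -- alike.
  have hclose : ∀ r, IsClose H (truncatedHam h (nbhd (S a) r)) (A a) (A a) 1
      (2 * c₀ ^ θ * Real.exp (-(μ / 2 * θ) * r)) (θ * v) := by
    intro r
    refine ⟨hA1 a, hA1 a, fun t => ?_⟩
    have h2 : ‖evol H t (A a) - evol (truncatedHam h (nbhd (S a) r)) t (A a)‖ ≤ 2 := by
      refine (norm_sub_le _ _).trans ?_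
      rw [norm_evol hH, norm_evol (hH' r)]
      linarith [hA1 a]
    have h3 := le_two_mul_rpow_of_le h2
      (hevol Λ hcard h hherm hsupp hphys hdecay (S a) (A a) (hAsupp a) (hS a) (hA1 a) r t)
      (by positivity) hθ0.le hθ1
    refine h3.trans (le_of_eq ?_)
    rw [Real.mul_rpow (by positivity) (by positivity), Real.mul_rpow hc₀.le (by positivity),
      ← Real.exp_mul, ← Real.exp_mul]
    ring_nf
  have hb := fun r => hbound Λ H (truncatedHam h (nbhd (S a) r)) (A a) _ hH (hH' r) (hA a) (hclose r)
  have hfac : ∀ r, c * (2 * c₀ ^ θ * Real.exp (-(μ / 2 * θ) * r)) ≤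
      ((2 * c + 3) * (c * (2 * c₀ ^ θ)) + 1) * Real.exp (-(μ / 2 * θ) * r) := by
    intro r
    rw [← mul_assoc]
    gcongr
    nlinarith [mul_nonneg hc hc₀θ, mul_nonneg hc (mul_nonneg hc hc₀θ)]
  refine ⟨fun r hr => ⟨?_, ?_⟩, fun r hr => ⟨?_, ?_⟩, fun r hr => ⟨?_, ?_⟩, fun r hr => ⟨?_, ?_⟩⟩
  · exact isSuperSupportedOn_parentTerm (hH' r) (hmem r) (hAmem r hr) (hA a) β
  · obtain ⟨_, hL, hG, hM, hn, hn'⟩ := hb r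
    refine (superNorm_parentTerm_sub_le hH (hH' r) (hA a) β hL hG hM hn hn').trans ?_
    rw [← mul_assoc c, ← mul_assoc (2 * c + 3)]
    gcongr
    linarith
  · simp only [← mem_supportAlgebra, lindbladOp_eq]
    exact bohrFilter_mem _ (hH' r) (hmem r) (hAmem r hr) _
  · exact (hb r).1.trans (hfac r)
  · exact mem_supportAlgebra.1 (tildeL_mem _ (hH' r) (hmem r) (hAmem r hr) β)
  · exact (hb r).2.1.trans (hfac r)
  · exact mem_supportAlgebra.1 (tildeG_mem _ (hH' r) (hmem r) (hAmem r hr) (hA a) β)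
  · exact (hb r).2.2.1.trans (hfac r)
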